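/- **Theorem (CPDAG consistency).** Let $V$ be a finite set, $G$ a directed acyclic graph (DAG) on $V$, and $P$ a probability distribution on $\mathbb{R}^V$ that is faithful to $G$: for $X\sim P$ and all pairwise disjoint $A,B,C\subseteq V$, $X_A \perp X_B \mid X_C$ if and only if $C$ d-separates $A$ and $B$ in $G$. Let $\mathbf X_1,\mathbf X_2,\dots$ be random vectors on a common probability space, each with law $P$, with no restriction on their dependence. Let $\mu(i,j|\mathbf k)\in\mathbb{R}$ (for $i\ne j$ in $V$, $\mathbf k\subseteq V\setminus\{i,j\}$) be a measure of conditional dependence, i.e. $\mu(i,j|\mathbf k)=0$ if and only if $X_i\perp X_j\mid (X_r)_{r\in\mathbf k}$, and let $\hat\mu_n(i,j|\mathbf k)$ be (measurable) functions of $\mathbf X_1,\dots,\mathbf X_n$ with $\hat\mu_n(i,j|\mathbf k)\to\mu(i,j|\mathbf k)$ in probability for all such $i,j,\mathbf k$. Let $\gamma>0$ be a threshold with $\gamma<|\mu(i,j|\mathbf k)|$ whenever $\mu(i,j|\mathbf k)\neq 0$. Let $G_{CPDAG}$ be the graph on $V$ that has $u\to v$ if $u\to v$ is in all DAGs that are Markov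 equivalent to $G$ (i.e. to which the same probability distributions on $\mathbb{R}^V$ are faithful), and $u-v$ if both $u\to v$ and $v\to u$ occur among these DAGs. The sample PC algorithm with the test that accepts independence of $i,j$ given $\mathbf k$ if and only if $|\hat\mu_n(i,j|\mathbf k)|\le\gamma$ is the following procedure. 1. *Skeleton.* Start with the complete undirected graph on $V$. For $\ell=0,1,2,\dots$, select one after the other, in any order and each at most once per $\ell$, the ordered pairs $(i,j)$ that are adjacent in the current graph with $|\mathrm{adj}(i)\setminus\{j\}|\ge \ell$. For the selected pair run, in any order, through the sets $\mathbf k\subseteq \mathrm{adj}(i)\setminus\{j\}$ with $|\mathbf k|=\ell$, until one is accepted; in that case delete the edge $i-j$ and set $S(i,j)=S(j,i)=\mathbf k$. Stop after the first $\ell$ at whose end $|\mathrm{adj}(i)\setminus\{j\}|\le\ell$ for all adjacent $i,j$. 2. *v-structures.* For all $i-c-j$ in the skeleton with $i,j$ distinct and non-adjacent and $c\notin S(i,j)$, orient $i\to c\leftarrow j$ (in any order; a later orientation of an edge overwrites an earlier one). 3. *Orientation rules.* As long as possible, and in any order, orient an undirected edge $i-j$ into $i\to j$ if for some $c$ (and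 $d$) one of the following holds: (R1) $c\to i$ with $c,j$ non-adjacent; (R2) $i\to c\to j$; (R3) $i-c\to j$ and $i-d\to j$ with $c,d$ distinct and non-adjacent; (R4) $i-c\to d\to j$ with $c,j$ non-adjacent. Then, as $n\to\infty$, the probability that the sample PC algorithm returns $G_{CPDAG}$, whatever choices it makes, tends to $1$. In particular, if $\hat G_{CPDAG,n}$ denotes its output, $\mathbb P(\hat G_{CPDAG,n}=G_{CPDAG})\to 1$. -/

import Mathlib

open MeasureTheory ProbabilityTheory Filter Topology

namespace PCAlg

/-! ### Directed graphs, d-separation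

A graph on `V` is a `Digraph V`: `G.Adj u v` says that `(u, v)` belongs to the edge set. The edge
between `u` and `v` is directed (`u → v`) if `(u, v)` is an edge and `(v, u)` is not, and undirected
(`u - v`) if both are. -/

section Graphs

variable {V : Type*}

/-- The directed edge `u → v`. -/
def DirEdge (G : Digraph V) (u v : V) : Prop := G.Adj u v ∧ ¬ G.Adj v u

/-- The undirected edge `u - v`. -/
def UndirEdge (G : Digraph V) (u v : V) : Prop := G.Adj u v ∧ G.Adj v u

/-- `u` and `v` are distinct nodes without an edge of any kind between them. -/
def NonAdjacent (G : Digraph V) (u v : V) : Prop := u ≠ v ∧ ¬ G.Adj u v ∧ ¬ G.Adj v u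

/-- Directed acyclic graph: no directed cycle (in particular no loop and no undirected edge). -/
def IsDAG (G : Digraph V) : Prop := ∀ v, ¬ Relation.TransGen G.Adj v v

/-- The skeleton: `u` and `w` are joined iff `u ≠ w` and `u → w` or `w → u`. -/
abbrev skeleton (G : Digraph V) : SimpleGraph V := G.toSimpleGraphInclusive

/-- `b` is a collider between its neighbours `a` and `c` on a path: `a → b ← c`. -/
def IsCollider (G : Digraph V) (a b c : V) : Prop := G.Adj a b ∧ G.Adj c b

/-- `b` is an ancestor of some element of `C` (every node is an ancestor of itself). -/
def IsAncestorOf (G : Digraph V) (b : V) (C : Finset V) : Prop :=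
  ∃ d ∈ C, Relation.ReflTransGen G.Adj b d

/-- `v` and `w` are d-connected given `C`: some path (distinct nodes, successive ones adjacent)
from `v` to `w` has all its colliders in the ancestors of `C` and no non-collider in `C`. -/
def DConnected (G : Digraph V) (v w : V) (C : Finset V) : Prop :=
  ∃ p : (skeleton G).Walk v w, p.IsPath ∧ ∀ m, m + 2 ≤ p.length →
    (IsCollider G (p.getVert m) (p.getVert (m + 1)) (p.getVert (m + 2)) →
      IsAncestorOf G (p.getVert (m + 1)) C) ∧
    (¬ IsCollider G (p.getVert m) (p.getVert (m + 1)) (p.getVert (m + 2)) →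
      p.getVert (m + 1) ∉ C)

/-- `C` d-separates `A` and `B` (used for pairwise disjoint `A`, `B`, `C`). -/
def DSeparates (G : Digraph V) (A B C : Finset V) : Prop :=
  ∀ v ∈ A, ∀ w ∈ B, ¬ DConnected G v w C

end Graphs

/-! ### Faithfulness, Markov equivalence, CPDAG -/

section Faithful

variable {V : Type*} [Fintype V]

/-- `X_A ⫫ X_B | X_C` for the coordinate vector `X = (X_v)_{v ∈ V}` with law `P` on `ℝ^V`. -/
def CondIndepCoord (P : Measure (V → ℝ)) [IsFiniteMeasure P] (A B C : Finset V) : Prop :=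
  CondIndepFun (MeasurableSpace.comap (C.restrict (π := fun _ => ℝ)) inferInstance)
    (Finset.measurable_restrict (X := fun _ : V => ℝ) C).comap_le
    (A.restrict (π := fun _ => ℝ)) (B.restrict (π := fun _ => ℝ)) P

/-- `P` is faithful to `G` (directed Markov property together with its converse): conditional
independence given `X_C` is the same as d-separation by `C`. -/
def Faithful (P : Measure (V → ℝ)) [IsFiniteMeasure P] (G : Digraph V) : Prop :=
  ∀ A B C : Finset V, Disjoint A B → Disjoint A C → Disjoint B C →
    (CondIndepCoord P A B C ↔ DSeparates G A B C)

/-- Markov equivalence: the same probability distributions are faithful to `G` and to `H`. -/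
def MarkovEquiv (G H : Digraph V) : Prop :=
  ∀ (P : Measure (V → ℝ)) [IsProbabilityMeasure P], Faithful P G ↔ Faithful P H

/-- The Markov equivalence class of `G`: all DAGs that are Markov equivalent to `G`. -/
def markovClass (G : Digraph V) : Set (Digraph V) := {H | IsDAG H ∧ MarkovEquiv G H}

/-- The CPDAG of the DAG `G`: it has `u → v` if `u → v` is in all DAGs of the Markov equivalence
class of `G`, and `u - v` if both `u → v` and `v → u` occur among these DAGs. -/
def cpdag (G : Digraph V) : Digraph V where
  Adj u v := (∀ H ∈ markovClass G, H.Adj u v) ∨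
    ((∃ H ∈ markovClass G, H.Adj u v) ∧ (∃ H ∈ markovClass G, H.Adj v u))

end Faithful

/-! ### The PC algorithm

`accept i j k` is the result of the query "is `i` independent of `j` given `k`?". The order in which
pairs, conditioning sets, triples and rules are chosen is left open by the algorithm, so it is
modelled as a nondeterministic procedure; `pcOutputs accept` is the set of the results of all its
executions. -/

section Algorithm

variable {V : Type*} [DecidableEq V]

/-- State of the skeleton search. `done` is the set of the ordered pairs already selected at the
current level `level`. -/
structure SkelState (V : Type*) where
  /-- current size of the conditioning sets -/
  level : ℕ
  /-- current undirected graph -/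
  skel : SimpleGraph V
  /-- separation sets -/
  sep : V → V → Finset V
  /-- ordered pairs already treated at this level -/
  done : Set (V × V)

/-- The search starts from the complete graph, at level `0`. -/
def SkelState.init (V : Type*) : SkelState V := ⟨0, ⊤, fun _ _ => ∅, ∅⟩

/-- The nodes from which conditioning sets for `(i, j)` are taken: `adj(i) \ {j}`. -/
def SkelState.nbrs (s : SkelState V) (i j : V) : Set V := s.skel.neighborSet i \ {j}

/-- `(i, j)` may be selected: it is an adjacent ordered pair with `|adj(i) \ {j}| ≥ level` that has
not been selected before at this level. -/
def SkelState.Selectable (s : SkelState V) (i j : V) : Prop :=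
  s.skel.Adj i j ∧ s.level ≤ (s.nbrs i j).ncard ∧ (i, j) ∉ s.done

/-- `k` is a conditioning set to be tried for `(i, j)`. -/
def SkelState.Candidate (s : SkelState V) (i j : V) (k : Finset V) : Prop :=
  (k : Set V) ⊆ s.nbrs i j ∧ k.card = s.level

/-- One round of the skeleton search. For a selected pair the candidate sets are tried in an
arbitrary order until one is accepted (`delete`) or none is left (`keep`). -/
inductive SkelStep (accept : V → V → Finset V → Prop) : SkelState V → SkelState V → Prop
  | delete (s : SkelState V) (i j : V) (k : Finset V) (hij : s.Selectable i j)
      (hk : s.Candidate i j k) (hacc : accept i j k) :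
      SkelStep accept s
        { level := s.level
          skel := s.skel.deleteEdges {s(i, j)}
          sep := fun a b => if (a = i ∧ b = j) ∨ (a = j ∧ b = i) then k else s.sep a b
          done := insert (i, j) s.done }
  | keep (s : SkelState V) (i j : V) (hij : s.Selectable i j)
      (hrej : ∀ k, s.Candidate i j k → ¬ accept i j k) :
      SkelStep accept s { s with done := insert (i, j) s.done }
  | nextLevel (s : SkelState V) (hdone : ∀ i j, ¬ s.Selectable i j)
      (hmore : ∃ i j, s.skel.Adj i j ∧ s.level < (s.nbrs i j).ncard) :
      SkelStep accept s { s with level := s.level + 1, done := ∅ }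

/-- The search stops when all pairs have been treated at the current level and
`|adj(i) \ {j}| ≤ level` for all adjacent `i`, `j`. -/
def SkelState.Final (s : SkelState V) : Prop :=
  (∀ i j, ¬ s.Selectable i j) ∧ ∀ i j, s.skel.Adj i j → (s.nbrs i j).ncard ≤ s.level

/-- Replace whatever edge there is between `u` and `v` by `u → v`. -/
def orient (E : Digraph V) (u v : V) : Digraph V where
  Adj a b := (a = u ∧ b = v) ∨ (E.Adj a b ∧ ¬ (a = v ∧ b = u))

/-- The triples `(i, c, j)` with `i - c - j` in the skeleton, `i`, `j` non-adjacent, and `c` outside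
the separation set of `i` and `j`. -/
def colliderTriples (s : SkelState V) : Set (V × V × V) :=
  {t | t.1 ≠ t.2.2 ∧ ¬ s.skel.Adj t.1 t.2.2 ∧ s.skel.Adj t.1 t.2.1 ∧ s.skel.Adj t.2.1 t.2.2 ∧
    t.2.1 ∉ s.sep t.1 t.2.2}

/-- Orient `i → c ← j`. -/
def orientCollider (E : Digraph V) (t : V × V × V) : Digraph V :=
  orient (orient E t.1 t.2.1) t.2.2 t.2.1

/-- The v-structure phase: starting from the undirected skeleton, all the collider triples are
oriented, in some order. -/
def ColliderPhase (s : SkelState V) (E : Digraph V) : Prop :=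
  ∃ l : List (V × V × V), l.Nodup ∧ (∀ t, t ∈ l ↔ t ∈ colliderTriples s) ∧
    E = l.foldl orientCollider ⟨s.skel.Adj⟩

/-- One of the four orientation rules orients the undirected edge `i - j` into `i → j`:
1. `c → i` with `c`, `j` non-adjacent;
2. `i → c → j`;
3. `i - c → j` and `i - d → j` with `c`, `d` non-adjacent;
4. `i - c → d` and `c → d → j` with `c`, `j` non-adjacent. -/
def RuleApplies (E : Digraph V) (i j : V) : Prop :=
  UndirEdge E i j ∧
    ((∃ c, DirEdge E c i ∧ NonAdjacent E c j) ∨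
     (∃ c, DirEdge E i c ∧ DirEdge E c j) ∨
     (∃ c d, UndirEdge E i c ∧ DirEdge E c j ∧ UndirEdge E i d ∧ DirEdge E d j ∧
        NonAdjacent E c d) ∨
     (∃ c d, UndirEdge E i c ∧ DirEdge E c d ∧ DirEdge E d j ∧ NonAdjacent E c j))

/-- One application of an orientation rule. -/
def RuleStep (E E' : Digraph V) : Prop := ∃ i j, RuleApplies E i j ∧ E' = orient E i j

/-- The graphs that executions of the PC algorithm with the test results `accept` can return:
skeleton search, v-structures, then orientation rules until none applies. -/
def pcOutputs (accept : V → V → Finset V → Prop) : Set (Digraph V) :=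
  {H | ∃ s : SkelState V, Relation.ReflTransGen (SkelStep accept) (SkelState.init V) s ∧ s.Final ∧
    ∃ E : Digraph V, ColliderPhase s E ∧ Relation.ReflTransGen RuleStep E H ∧
      ∀ i j, ¬ RuleApplies H i j}

/-- The possible outputs of the sample PC algorithm on a data set `x` of size `n`: conditional
independence of `i` and `j` given `k` is accepted iff `|stat i j k x| ≤ γ`. -/
def samplePCOutputs {n : ℕ} (stat : V → V → Finset V → (Fin n → V → ℝ) → ℝ) (γ : ℝ)
    (x : Fin n → V → ℝ) : Set (Digraph V) :=
  pcOutputs fun i j k => |stat i j k x| ≤ γ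

end Algorithm

end PCAlg

/-! By faithfulness, the true answers to the independence queries are the d-separations of `G`.
There are finitely many queries, and `γ` separates zero from the nonzero values of `mu`. So each
sample answer is right as soon as the estimate is within a fixed distance of its limit, and by a
union bound all answers are right with probability tending to one, whatever the dependence of the
observations. What remains is deterministic: with a d-separation oracle every run returns the CPDAG
(`pcOutputs_eq`).

Skeleton and v-structures: adjacent vertices are never separated, so true edges survive.
Non-adjacent ones are separated by the parents of one of them (`not_dConnected_parents`), a set that
stays available to the search. On an unshielded triple a separating set omits the middle vertex
exactly at a collider (`notMem_sepset_iff`), so the second phase produces `pattern G`.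

Markov class: it consists of the DAGs with the skeleton and v-structures of `G` (`markovClass_eq`).
Such DAGs are linked by reversals of covered edges (`SamePattern.exists_covered`), and these
preserve d-connection. The latter is checked on walks that may repeat vertices
(`dConnected_iff_reach`), which can be rerouted edge by edge.

Orientation rules: they are sound for the whole class. For completeness (Meek), a closed graph
satisfies: `a → b - c` forces `a → c` (`Sound.dirEdge_trans`). Its undirected part has a perfect
elimination order ending in any prescribed vertex `u` (`exists_elimination_order`). Orienting along
that order creates neither cycles nor v-structures and makes `u` a source among its undirected
neighbours, so every undirected edge occurs both ways in the class. -/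

namespace PCAlg

/-! ### d-connection by paths, by active walks and by reachability -/

section DSeparation

variable {V : Type*}

theorem IsDAG.irrefl {G : Digraph V} (hG : IsDAG G) (a : V) : ¬ G.Adj a a :=
  fun h => hG a (.single h)

theorem IsDAG.ne {G : Digraph V} (hG : IsDAG G) {a b : V} (h : G.Adj a b) : a ≠ b := by
  rintro rfl
  exact hG.irrefl _ h

theorem IsDAG.asymm {G : Digraph V} (hG : IsDAG G) {a b : V} (h : G.Adj a b) : ¬ G.Adj b a :=
  fun h' => hG a (.tail (.single h) h')

theorem IsDAG.not_triangle {G : Digraph V} (hG : IsDAG G) {a b c : V} (h : G.Adj a b)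
    (h' : G.Adj b c) : ¬ G.Adj c a :=
  fun h'' => hG a (.tail (.tail (.single h) h') h'')

theorem skeleton_adj {G : Digraph V} {a b : V} :
    (skeleton G).Adj a b ↔ a ≠ b ∧ (G.Adj a b ∨ G.Adj b a) := by
  simp [skeleton, Digraph.toSimpleGraphInclusive, SimpleGraph.fromRel_adj]

theorem IsDAG.skeleton_adj {G : Digraph V} (hG : IsDAG G) {a b : V} :
    (skeleton G).Adj a b ↔ G.Adj a b ∨ G.Adj b a := by
  rw [PCAlg.skeleton_adj]
  refine ⟨fun h => h.2, fun h => ⟨?_, h⟩⟩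
  rcases h with h | h
  · exact hG.ne h
  · exact (hG.ne h).symm

/-- `Reach G C v b u`: there is a walk from `v` to `u` whose colliders lie in `C` and whose
non-colliders do not; `b = true` means that its last edge points into `u`. The start `v` is
treated as if it were left along the tail of an edge. -/
inductive Reach (G : Digraph V) (C : Finset V) (v : V) : Bool → V → Prop
  | start : Reach G C v false v
  | down {b : Bool} {u w : V} (h : Reach G C v b u) (hu : u ∉ C) (e : G.Adj u w) :
      Reach G C v true w
  | back {u w : V} (h : Reach G C v false u) (hu : u ∉ C) (e : G.Adj w u) : Reach G C v false w
  | up {u w : V} (h : Reach G C v true u) (hu : u ∈ C) (e : G.Adj w u) : Reach G C v false w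

/-- The vertices `f 0, …, f n` form a walk in `G` which is active given `C`: its colliders are
ancestors of `C` and its non-colliders are outside `C`. -/
structure ActiveSeq (G : Digraph V) (C : Finset V) (f : ℕ → V) (n : ℕ) : Prop where
  adj : ∀ m < n, G.Adj (f m) (f (m + 1)) ∨ G.Adj (f (m + 1)) (f m)
  collider : ∀ m, m + 2 ≤ n → G.Adj (f m) (f (m + 1)) → G.Adj (f (m + 2)) (f (m + 1)) →
    IsAncestorOf G (f (m + 1)) C
  noncollider : ∀ m, m + 2 ≤ n → ¬ (G.Adj (f m) (f (m + 1)) ∧ G.Adj (f (m + 2)) (f (m + 1))) →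
    f (m + 1) ∉ C

/-- A collider that is only an ancestor of `C` is replaced by a detour: descend to the first vertex
in `C`, turn round there, and climb back the same way. -/
theorem Reach.of_ancestor {G : Digraph V} {C : Finset V} {v u w : V} (h : Reach G C v true u)
    (hu : IsAncestorOf G u C) (e : G.Adj w u) : Reach G C v false w := by
  obtain ⟨d, hd, hud⟩ := hu
  have key : Reach G C v true u → u ∉ C → Reach G C v false u := by
    clear h e
    induction hud using Relation.ReflTransGen.head_induction_on with
    | refl => exact fun _ h => absurd hd h
    | @head a c hac _ ih =>
      intro h ha
      have hc : Reach G C v true c := h.down ha hac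
      by_cases hcC : c ∈ C
      · exact hc.up hcC hac
      · exact (ih hc hcC).back hcC hac
  by_cases huC : u ∈ C
  · exact h.up huC e
  · exact (key h huC).back huC e

theorem ActiveSeq.reach {G : Digraph V} (hG : IsDAG G) {C : Finset V} {f : ℕ → V} {n : ℕ}
    (hf : ActiveSeq G C f n) (h0 : f 0 ∉ C) (m : ℕ) (hm : m < n) :
    (G.Adj (f m) (f (m + 1)) → Reach G C (f 0) true (f (m + 1))) ∧
      (G.Adj (f (m + 1)) (f m) → Reach G C (f 0) false (f (m + 1))) := by
  induction m with
  | zero => exact ⟨fun h => .down .start h0 h, fun h => .back .start h0 h⟩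
  | succ m ih =>
    obtain ⟨ih1, ih2⟩ := ih (by omega)
    have hadj := hf.adj m (by omega)
    have hr : ∃ b, Reach G C (f 0) b (f (m + 1)) := by
      rcases hadj with h | h
      · exact ⟨_, ih1 h⟩
      · exact ⟨_, ih2 h⟩
    obtain ⟨b, hb⟩ := hr
    refine ⟨fun h => hb.down (hf.noncollider m (by omega) fun h' => hG.asymm h h'.2) h, fun h => ?_⟩
    rcases hadj with h' | h'
    · exact (ih1 h').of_ancestor (hf.collider m (by omega) h' h) h
    · exact (ih2 h').back (hf.noncollider m (by omega) fun h'' => hG.asymm h' h''.1) h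

theorem ActiveSeq.snoc {G : Digraph V} {C : Finset V} {f : ℕ → V} {n : ℕ}
    (hf : ActiveSeq G C f n) (w : V) (hw : G.Adj (f n) w ∨ G.Adj w (f n))
    (hcol : ∀ m, m + 1 = n → G.Adj (f m) (f n) → G.Adj w (f n) → IsAncestorOf G (f n) C)
    (hnon : ∀ m, m + 1 = n → ¬ (G.Adj (f m) (f n) ∧ G.Adj w (f n)) → f n ∉ C) :
    ActiveSeq G C (fun k => if k ≤ n then f k else w) (n + 1) := by
  refine ⟨fun m hm => ?_, fun m hm => ?_, fun m hm => ?_⟩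
  · rcases Nat.lt_succ_iff_lt_or_eq.mp hm with h | rfl
    · simpa [h.le, Nat.succ_le_of_lt h] using hf.adj m h
    · simpa using hw
  · rcases Nat.lt_or_ge n (m + 2) with h | h
    · obtain rfl : n = m + 1 := by omega
      simpa using hcol m rfl
    · simpa [h, show m ≤ n by omega, show m + 1 ≤ n by omega] using hf.collider m h
  · rcases Nat.lt_or_ge n (m + 2) with h | h
    · obtain rfl : n = m + 1 := by omega
      simpa using hnon m rfl
    · simpa [h, show m ≤ n by omega, show m + 1 ≤ n by omega] using hf.noncollider m h

/-- The direction of the last edge is carried through the induction because it decides whether the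
current endpoint becomes a collider when the walk is extended. -/
theorem Reach.exists_activeSeq {G : Digraph V} (hG : IsDAG G) {C : Finset V} {v u : V} {b : Bool}
    (h : Reach G C v b u) :
    ∃ f n, ActiveSeq G C f n ∧ f 0 = v ∧ f n = u ∧
      (∀ m, m + 1 = n → (b = true ↔ G.Adj (f m) (f n))) ∧ (n = 0 → b = false) := by
  induction h with
  | start =>
    refine ⟨fun _ => v, 0, ⟨?_, ?_, ?_⟩, rfl, rfl, ?_, fun _ => rfl⟩ <;> intros <;> omega
  | @down b u w _ hu e ih =>
    obtain ⟨f, n, hf, h0, rfl, -, -⟩ := ih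
    refine ⟨_, _, hf.snoc w (.inl e) (fun m _ _ h => absurd h (hG.asymm e)) (fun _ _ _ => hu),
      by simpa using h0, by simp, fun m hm => ?_, fun h => by omega⟩
    obtain rfl : m = n := by omega
    simpa using e
  | @back u w _ hu e ih =>
    obtain ⟨f, n, hf, h0, rfl, hb, -⟩ := ih
    refine ⟨_, _, hf.snoc w (.inr e) (fun m hm h _ => absurd ((hb m hm).2 h) (by simp))
      (fun _ _ _ => hu), by simpa using h0, by simp, fun m hm => ?_, fun h => by omega⟩
    obtain rfl : m = n := by omega
    simpa using hG.asymm e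
  | @up u w _ hu e ih =>
    obtain ⟨f, n, hf, h0, rfl, hb, -⟩ := ih
    refine ⟨_, _, hf.snoc w (.inr e) (fun m hm h _ => ⟨_, hu, .refl⟩)
      (fun m hm h => absurd ⟨(hb m hm).1 rfl, e⟩ h), by simpa using h0, by simp, fun m hm => ?_,
      fun h => by omega⟩
    obtain rfl : m = n := by omega
    simpa using hG.asymm e

theorem IsAncestorOf.of_reach {G : Digraph V} {C : Finset V} {a b : V} (h : IsAncestorOf G b C)
    (hab : Relation.ReflTransGen G.Adj a b) : IsAncestorOf G a C :=
  let ⟨d, hd, hbd⟩ := h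
  ⟨d, hd, hab.trans hbd⟩

/-- Starting with an edge `f i → f (i + 1)`, an active walk is directed until it meets a
collider. -/
theorem ActiveSeq.directed_or_ancestor {G : Digraph V} {C : Finset V} {f : ℕ → V} {n : ℕ}
    (hf : ActiveSeq G C f n) {i : ℕ} (hi : G.Adj (f i) (f (i + 1))) (k : ℕ) (hk : i + k + 1 ≤ n) :
    IsAncestorOf G (f i) C ∨
      (Relation.TransGen G.Adj (f i) (f (i + k + 1)) ∧ G.Adj (f (i + k)) (f (i + k + 1))) := by
  induction k with
  | zero => exact .inr ⟨.single hi, hi⟩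
  | succ k ih =>
    rcases ih (by omega) with h | ⟨h, e⟩
    · exact .inl h
    · rcases hf.adj (i + k + 1) (by omega) with h' | h'
      · exact .inr ⟨h.tail h', h'⟩
      · exact .inl ((hf.collider (i + k) (by omega) e h').of_reach h.to_reflTransGen)

/-- The walk obtained by cutting out the closed part between two visits of the same vertex is
again active. -/
theorem ActiveSeq.shortcut {G : Digraph V} (hG : IsDAG G) {C : Finset V} {f : ℕ → V} {n : ℕ}
    (hf : ActiveSeq G C f n) {i d : ℕ} (hd : 0 < d) (hn : i + d ≤ n) (heq : f i = f (i + d)) :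
    ActiveSeq G C (fun k => if k ≤ i then f k else f (k + d)) (n - d) := by
  have hlow : ∀ k, k ≤ i → (if k ≤ i then f k else f (k + d)) = f k := fun k hk => by simp [hk]
  have hhigh : ∀ k, i ≤ k → (if k ≤ i then f k else f (k + d)) = f (k + d) := fun k hk => by
    rcases hk.eq_or_lt with rfl | h
    · simpa using heq
    · simp [Nat.not_le.mpr h]
  -- The cut may create a new collider. If the removed loop starts with an outgoing edge, it cannot
  -- be directed all the way round, so it meets a collider, of which `f i` is an ancestor; otherwise
  -- `f i` was already a collider at its first visit.
  have hcol : ∀ m, m + 1 = i → i + d + 1 ≤ n → G.Adj (f m) (f i) → IsAncestorOf G (f i) C := by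
    intro m hm hn' h
    subst hm
    rcases hf.adj (m + 1) (by omega) with h' | h'
    · obtain ⟨k, rfl⟩ : ∃ k, d = k + 1 := ⟨d - 1, by omega⟩
      rcases hf.directed_or_ancestor h' k (by omega) with h'' | ⟨h'', -⟩
      · exact h''
      · rw [← add_assoc] at heq
        rw [← heq] at h''
        exact absurd h'' (hG _)
    · exact hf.collider m (by omega) h h'
  refine ⟨fun m hm => ?_, fun m hm => ?_, fun m hm => ?_⟩
  · rcases Nat.lt_or_ge m i with h | h
    · rw [hlow m h.le, hlow (m + 1) h]
      exact hf.adj m (by omega)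
    · rw [hhigh m h, hhigh (m + 1) (by omega), show m + 1 + d = m + d + 1 by omega]
      exact hf.adj (m + d) (by omega)
  · rcases Nat.lt_trichotomy (m + 1) i with h | h | h
    · rw [hlow m (by omega), hlow (m + 1) h.le, hlow (m + 2) h]
      exact hf.collider m (by omega)
    · rw [hlow m (by omega), hlow (m + 1) h.le, h]
      exact fun h' _ => hcol m h (by omega) h'
    · rw [hhigh m (by omega), hhigh (m + 1) (by omega), hhigh (m + 2) (by omega),
        show m + 1 + d = m + d + 1 by omega, show m + 2 + d = m + d + 2 by omega]
      exact hf.collider (m + d) (by omega)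
  · rcases Nat.lt_trichotomy (m + 1) i with h | h | h
    · rw [hlow m (by omega), hlow (m + 1) h.le, hlow (m + 2) h]
      exact hf.noncollider m (by omega)
    · subst h
      rw [hlow m (by omega), hlow (m + 1) le_rfl, hhigh (m + 2) (by omega)]
      intro h'
      -- A non-collider after the cut was a non-collider at one of its two visits: the second if the
      -- incoming edge points into it, the first otherwise.
      by_cases h1 : G.Adj (f m) (f (m + 1))
      · rw [heq] at h' h1 ⊢
        rw [show m + 1 + d = m + d + 1 by omega] at *
        refine hf.noncollider (m + d) (by omega) fun h2 => h' ⟨h1, ?_⟩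
        rw [show m + 2 + d = m + d + 2 by omega]
        exact h2.2
      · exact hf.noncollider m (by omega) fun h2 => h1 h2.1
    · rw [hhigh m (by omega), hhigh (m + 1) (by omega), hhigh (m + 2) (by omega),
        show m + 1 + d = m + d + 1 by omega, show m + 2 + d = m + d + 2 by omega]
      exact hf.noncollider (m + d) (by omega)

theorem exists_walk_of_seq (S : SimpleGraph V) (n : ℕ) :
    ∀ f : ℕ → V, (∀ m < n, S.Adj (f m) (f (m + 1))) →
      ∃ p : S.Walk (f 0) (f n), p.length = n ∧ ∀ k ≤ n, p.getVert k = f k := by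
  induction n with
  | zero => exact fun f _ => ⟨.nil, rfl, fun k hk => by simp [Nat.le_zero.mp hk]⟩
  | succ n ih =>
    intro f hf
    obtain ⟨p, hp, hpf⟩ := ih (fun k => f (k + 1)) fun m hm => hf (m + 1) (by omega)
    refine ⟨.cons (hf 0 (by omega)) p, by simp [hp], fun k hk => ?_⟩
    rcases k with _ | k
    · simp
    · simpa using hpf k (by omega)

theorem ActiveSeq.dConnected {G : Digraph V} (hG : IsDAG G) {C : Finset V} {f : ℕ → V} {n : ℕ}
    (hf : ActiveSeq G C f n) : DConnected G (f 0) (f n) C := by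
  classical
  -- A shortest active walk repeats no vertex, since `ActiveSeq.shortcut` would shorten it.
  have hex : ∃ n', ∃ g : ℕ → V, ActiveSeq G C g n' ∧ g 0 = f 0 ∧ g n' = f n := ⟨n, f, hf, rfl, rfl⟩
  obtain ⟨g, hg, hg0, hgn⟩ := Nat.find_spec hex
  set N := Nat.find hex with hN
  have hinj : ∀ i j, i < j → j ≤ N → g i ≠ g j := by
    intro i j hij hj heq
    obtain ⟨d, rfl⟩ : ∃ d, j = i + d := ⟨j - i, by omega⟩
    refine Nat.find_min hex (m := N - d) (by omega)
      ⟨_, hg.shortcut hG (i := i) (d := d) (by omega) hj heq, by simpa using hg0, ?_⟩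
    split_ifs with h
    · obtain h1 : N - d = i := by omega
      rw [h1, heq, ← hgn]
      congr 1
      omega
    · rw [← hgn]
      congr 1
      omega
  obtain ⟨p, hp, hpg⟩ := exists_walk_of_seq (skeleton G) N g fun m hm =>
    hG.skeleton_adj.2 (hg.adj m hm)
  rw [← hg0, ← hgn]
  refine ⟨p, ?_, fun m hm => ?_⟩
  · rw [← SimpleGraph.Walk.IsPath.getVert_injOn_iff]
    intro i hi j hj hij
    simp only [Set.mem_ofPred_eq, hp] at hi hj
    rw [hpg i hi, hpg j hj] at hij
    rcases Nat.lt_trichotomy i j with h | h | h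
    · exact absurd hij (hinj i j h hj)
    · exact h
    · exact absurd hij.symm (hinj j i h hi)
  · rw [hp] at hm
    rw [hpg m (by omega), hpg (m + 1) (by omega), hpg (m + 2) hm]
    exact ⟨fun h => hg.collider m hm h.1 h.2, fun h => hg.noncollider m hm h⟩

theorem dConnected_iff_reach {G : Digraph V} (hG : IsDAG G) {C : Finset V} {v w : V} (hv : v ∉ C) :
    DConnected G v w C ↔ ∃ b, Reach G C v b w := by
  constructor
  · rintro ⟨p, -, hp⟩
    have hf : ActiveSeq G C p.getVert p.length :=
      ⟨fun m hm => hG.skeleton_adj.1 (p.adj_getVert_succ hm),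
        fun m hm h h' => (hp m hm).1 ⟨h, h'⟩, fun m hm h => (hp m hm).2 h⟩
    rcases Nat.eq_zero_or_pos p.length with h | h
    · rw [SimpleGraph.Walk.eq_of_length_eq_zero h]
      exact ⟨_, .start⟩
    · obtain ⟨m, hm⟩ : ∃ m, p.length = m + 1 := ⟨p.length - 1, by omega⟩
      have hr := hf.reach hG (by simpa using hv) m (by omega)
      rw [← hm, p.getVert_length, p.getVert_zero] at hr
      rcases hf.adj m (by omega) with h' | h' <;> rw [← hm, p.getVert_length] at h'
      · exact ⟨_, hr.1 h'⟩
      · exact ⟨_, hr.2 h'⟩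
  · rintro ⟨b, hb⟩
    obtain ⟨f, n, hf, rfl, rfl, -, -⟩ := hb.exists_activeSeq hG
    exact hf.dConnected hG

end DSeparation

/-! ### Reversing covered edges -/

section CoveredEdges

variable {V : Type*}

/-- `a → b ← c` with `a` and `c` non-adjacent. -/
def VStruct (G : Digraph V) (a b c : V) : Prop := NonAdjacent G a c ∧ IsCollider G a b c

theorem NonAdjacent.symm {G : Digraph V} {a b : V} (h : NonAdjacent G a b) : NonAdjacent G b a :=
  ⟨h.1.symm, h.2.2, h.2.1⟩

theorem nonAdjacent_congr {G H : Digraph V} {a b : V}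
    (h : (H.Adj a b ∨ H.Adj b a) ↔ (G.Adj a b ∨ G.Adj b a)) :
    NonAdjacent H a b ↔ NonAdjacent G a b := by
  unfold NonAdjacent
  tauto

theorem VStruct.symm {G : Digraph V} {a b c : V} (h : VStruct G a b c) : VStruct G c b a :=
  ⟨h.1.symm, h.2.2, h.2.1⟩

/-- The edge `x → y` of `G` is covered (`x` and `y` have the same parents apart from `x`), and `H`
is the result of reversing it. -/
structure CoveredReversal (G H : Digraph V) (x y : V) : Prop where
  adj : G.Adj x y
  not_adj : ¬ G.Adj y x
  adj' : H.Adj y x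
  not_adj' : ¬ H.Adj x y
  other : ∀ a b, ¬ (a = x ∧ b = y) → ¬ (a = y ∧ b = x) → (G.Adj a b ↔ H.Adj a b)
  parents : ∀ q, q ≠ x → q ≠ y → (G.Adj q x ↔ G.Adj q y)
  loop : ¬ G.Adj x x
  loop' : ¬ G.Adj y y

namespace CoveredReversal

variable {G H : Digraph V} {x y : V}

theorem ne (h : CoveredReversal G H x y) : x ≠ y := by
  rintro rfl
  exact h.loop h.adj

theorem symm (h : CoveredReversal G H x y) : CoveredReversal H G y x where
  adj := h.adj'
  not_adj := h.not_adj'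
  adj' := h.adj
  not_adj' := h.not_adj
  other a b h1 h2 := (h.other a b h2 h1).symm
  parents q hqy hqx := by
    rw [← h.other q y (fun h => hqx h.1) (fun h => hqy h.1),
      ← h.other q x (fun h => hqx h.1) (fun h => hqy h.1), h.parents q hqx hqy]
  loop h' := h.loop' ((h.other y y (fun h' => h.ne h'.1.symm) (fun h' => h.ne h'.2.symm)).2 h')
  loop' h' := h.loop ((h.other x x (fun h' => h.ne h'.2) (fun h' => h.ne h'.1)).2 h')

/-- Up to its end the path uses only edges of `G`. It cannot enter `y`: its last vertex before `y`
would be a parent of `y` other than `x`, hence a parent of `x`, closing a cycle in `G`. -/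
theorem transGen (h : CoveredReversal G H x y) (hG : IsDAG G) {b : V}
    (hb : Relation.TransGen H.Adj x b) : Relation.TransGen G.Adj x b ∧ b ≠ y := by
  induction hb with
  | @single b hb =>
    have hby : b ≠ y := by rintro rfl; exact h.not_adj' hb
    exact ⟨.single ((h.other x b (fun h => hby h.2) (fun h' => h.ne h'.1)).2 hb), hby⟩
  | @tail b c _ hbc ih =>
    obtain ⟨ih, hby⟩ := ih
    have hbx : b ≠ x := by rintro rfl; exact hG _ ih
    have e : G.Adj b c := (h.other b c (fun h => hbx h.1) (fun h => hby h.1)).2 hbc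
    refine ⟨ih.tail e, ?_⟩
    rintro rfl
    exact hG x (ih.tail ((h.parents b hbx hby).2 e))

theorem transGen_or (h : CoveredReversal G H x y) {a b : V} (hab : Relation.TransGen H.Adj a b) :
    Relation.TransGen G.Adj a b ∨
      (Relation.ReflTransGen H.Adj a y ∧ Relation.ReflTransGen H.Adj x b) := by
  have edge : ∀ {b c}, H.Adj b c → G.Adj b c ∨ (b = y ∧ c = x) := by
    intro b c hbc
    by_cases h1 : b = y ∧ c = x
    · exact .inr h1
    · refine .inl ((h.other b c ?_ h1).2 hbc)
      rintro ⟨rfl, rfl⟩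
      exact h.not_adj' hbc
  induction hab with
  | single hab =>
    rcases edge hab with h | ⟨rfl, rfl⟩
    · exact .inl (.single h)
    · exact .inr ⟨.refl, .refl⟩
  | @tail b c hab hbc ih =>
    rcases ih with ih | ⟨h1, h2⟩
    · rcases edge hbc with h | ⟨rfl, rfl⟩
      · exact .inl (ih.tail h)
      · exact .inr ⟨hab.to_reflTransGen, .refl⟩
    · exact .inr ⟨h1, h2.tail hbc⟩

theorem isDAG (h : CoveredReversal G H x y) (hG : IsDAG G) : IsDAG H := by
  intro v hv
  rcases h.transGen_or hv with h1 | ⟨h1, h2⟩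
  · exact hG v h1
  · rcases Relation.reflTransGen_iff_eq_or_transGen.1 (h2.trans h1) with h3 | h3
    · exact h.ne h3.symm
    · exact (h.transGen hG h3).2 rfl

theorem adj_or (h : CoveredReversal G H x y) (a b : V) :
    (H.Adj a b ∨ H.Adj b a) ↔ (G.Adj a b ∨ G.Adj b a) := by
  by_cases h1 : a = x ∧ b = y
  · obtain ⟨rfl, rfl⟩ := h1
    exact ⟨fun _ => .inl h.adj, fun _ => .inr h.adj'⟩
  by_cases h2 : a = y ∧ b = x
  · obtain ⟨rfl, rfl⟩ := h2
    exact ⟨fun _ => .inr h.adj, fun _ => .inl h.adj'⟩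
  rw [h.other a b h1 h2, h.other b a (fun h => h2 ⟨h.2, h.1⟩) (fun h => h1 ⟨h.2, h.1⟩)]

theorem nonAdjacent_iff (h : CoveredReversal G H x y) (a b : V) :
    NonAdjacent H a b ↔ NonAdjacent G a b :=
  nonAdjacent_congr (h.adj_or a b)

/-- The reversed edge belongs to no v-structure at `y`: any other parent of `y` is also a parent of
`x`, so the triple is shielded. -/
theorem vStruct_of (h : CoveredReversal G H x y) {a b c : V} (hv : VStruct G a b c) :
    VStruct H a b c := by
  obtain ⟨hn, hab, hcb⟩ := hv
  have key : ∀ a c, NonAdjacent G a c → G.Adj a b → G.Adj c b → H.Adj a b := by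
    intro a c hn hab hcb
    refine (h.other a b ?_ ?_).1 hab
    · rintro ⟨rfl, rfl⟩
      have hcy : c ≠ b := by rintro rfl; exact h.loop' hcb
      exact hn.2.2 ((h.parents c hn.1.symm hcy).2 hcb)
    · rintro ⟨rfl, rfl⟩
      exact h.not_adj hab
  exact ⟨(h.nonAdjacent_iff a c).2 hn, key a c hn hab hcb, key c a hn.symm hcb hab⟩

theorem vStruct_iff (h : CoveredReversal G H x y) (a b c : V) :
    VStruct H a b c ↔ VStruct G a b c :=
  ⟨h.symm.vStruct_of, h.vStruct_of⟩

/-- What the states reached in `G` mean for the graph `H` in which the covered edge `x → y` is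
reversed. -/
def Simulated (H : Digraph V) (C : Finset V) (x y v : V) (b : Bool) (u : V) : Prop :=
  (u ≠ x → u ≠ y → Reach H C v b u) ∧
  (u = x → b = true → Reach H C v true x ∧ Reach H C v true y) ∧
  (u = x → b = false → Reach H C v false x ∨ (y ∉ C ∧ Reach H C v false y) ∨
    (y ∈ C ∧ Reach H C v true x ∧ Reach H C v true y)) ∧
  (u = y → b = true → (Reach H C v true x ∧ Reach H C v true y) ∨
    (x ∉ C ∧ Reach H C v false x) ∨ (x ∉ C ∧ y ∉ C ∧ Reach H C v false y)) ∧
  (u = y → b = false → Reach H C v false y)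

theorem Simulated.of_ne {C : Finset V} {v u : V} {b : Bool} (hx : u ≠ x) (hy : u ≠ y)
    (h : Reach H C v b u) : Simulated H C x y v b u :=
  ⟨fun _ _ => h, fun h => absurd h hx, fun h => absurd h hx, fun h => absurd h hy,
    fun h => absurd h hy⟩

/-- Away from `x` and `y` the walk is copied. A passage through the edge between them is rerouted
using that `x` and `y` have the same other parents: a walk entering one from such a parent can enter
the other, and one leaving towards such a parent can leave from either. The alternatives in
`Simulated` postpone the choice until the next edge is known. -/
theorem simulated (h : CoveredReversal G H x y) {C : Finset V} {v u : V} {b : Bool}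
    (hr : Reach G C v b u) : Simulated H C x y v b u := by
  have hxy := h.ne
  have hHG : ∀ {a b}, (a ≠ x ∨ b ≠ y) → (a ≠ y ∨ b ≠ x) → G.Adj a b → H.Adj a b :=
    fun h1 h2 e => (h.other _ _ (by tauto) (by tauto)).1 e
  induction hr with
  | start =>
    refine ⟨fun _ _ => .start, fun _ h => by simp at h, ?_, fun _ h => by simp at h, ?_⟩
    · rintro rfl -
      exact .inl .start
    · rintro rfl -
      exact .start
  | @down b u w _ hu e ih =>
    obtain ⟨i1, i2, i3, i4, i5⟩ := ih
    by_cases hux : u = x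
    · subst hux
      have hwu : w ≠ u := by rintro rfl; exact h.loop e
      by_cases hwy : w = y
      · subst hwy
        refine ⟨fun _ h => absurd rfl h, fun h => absurd h hwu, fun h => absurd h hwu,
          fun _ _ => ?_, fun _ h => by simp at h⟩
        cases b
        · rcases i3 rfl rfl with h' | h' | h'
          · exact .inr (.inl ⟨hu, h'⟩)
          · exact .inr (.inr ⟨hu, h'⟩)
          · exact .inl h'.2
        · exact .inl (i2 rfl rfl)
      · refine .of_ne hwu hwy ?_
        have e' : H.Adj u w := hHG (.inr hwy) (.inl hxy) e
        cases b
        · rcases i3 rfl rfl with h' | h' | h'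
          · exact h'.down hu e'
          · exact (h'.2.down h'.1 h.adj').down hu e'
          · exact h'.2.1.down hu e'
        · exact (i2 rfl rfl).1.down hu e'
    by_cases huy : u = y
    · subst huy
      have hwu : w ≠ u := by rintro rfl; exact h.loop' e
      have hwx : w ≠ x := by rintro rfl; exact h.not_adj e
      refine .of_ne hwx hwu ?_
      have e' : H.Adj u w := hHG (.inl hux) (.inr hwx) e
      cases b
      · exact (i5 rfl rfl).down hu e'
      · rcases i4 rfl rfl with h' | h' | h'
        · exact h'.2.down hu e'
        · exact (h'.2.back h'.1 h.adj').down hu e'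
        · exact h'.2.2.down hu e'
    have hr := i1 hux huy
    have e' : H.Adj u w := hHG (.inl hux) (.inl huy) e
    by_cases hw : w = x ∨ w = y
    · have hA : Reach H C v true x ∧ Reach H C v true y := by
        have hp : G.Adj u x ∧ G.Adj u y := by
          rcases hw with rfl | rfl
          · exact ⟨e, (h.parents u hux huy).1 e⟩
          · exact ⟨(h.parents u hux huy).2 e, e⟩
        exact ⟨hr.down hu (hHG (.inl hux) (.inl huy) hp.1),
          hr.down hu (hHG (.inl hux) (.inl huy) hp.2)⟩
      exact ⟨fun h1 h2 => absurd hw (by tauto), fun _ _ => hA, fun _ h => by simp at h,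
        fun _ _ => .inl hA, fun _ h => by simp at h⟩
    · exact .of_ne (by tauto) (by tauto) (hr.down hu e')
  | @back u w _ hu e ih =>
    obtain ⟨i1, i2, i3, i4, i5⟩ := ih
    by_cases hux : u = x
    · subst hux
      have hwu : w ≠ u := by rintro rfl; exact h.loop e
      have hwy : w ≠ y := by rintro rfl; exact h.not_adj e
      have e' : H.Adj w u := hHG (.inl hwu) (.inl hwy) e
      have e'' : H.Adj w y := hHG (.inl hwu) (.inl hwy) ((h.parents w hwu hwy).1 e)
      refine .of_ne hwu hwy ?_
      rcases i3 rfl rfl with h' | h' | h'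
      · exact h'.back hu e'
      · exact h'.2.back h'.1 e''
      · exact h'.2.2.up h'.1 e''
    by_cases huy : u = y
    · subst huy
      have hwu : w ≠ u := by rintro rfl; exact h.loop' e
      by_cases hwx : w = x
      · subst hwx
        exact ⟨fun h => absurd rfl h, fun _ h => by simp at h, fun _ _ => .inr (.inl ⟨hu, i5 rfl rfl⟩),
          fun h => absurd h hwu, fun h => absurd h hwu⟩
      · exact .of_ne hwx hwu ((i5 rfl rfl).back hu (hHG (.inl hwx) (.inl hwu) e))
    have hr := (i1 hux huy).back hu (hHG (.inr huy) (.inr hux) e)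
    refine ⟨fun _ _ => hr, fun _ h => by simp at h, ?_, fun _ h => by simp at h, ?_⟩
    · rintro rfl -
      exact .inl hr
    · rintro rfl -
      exact hr
  | @up u w _ hu e ih =>
    obtain ⟨i1, i2, i3, i4, i5⟩ := ih
    by_cases hux : u = x
    · subst hux
      have hwu : w ≠ u := by rintro rfl; exact h.loop e
      have hwy : w ≠ y := by rintro rfl; exact h.not_adj e
      exact .of_ne hwu hwy ((i2 rfl rfl).1.up hu (hHG (.inl hwu) (.inl hwy) e))
    by_cases huy : u = y
    · subst huy
      have hwu : w ≠ u := by rintro rfl; exact h.loop' e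
      by_cases hwx : w = x
      · subst hwx
        refine ⟨fun h => absurd rfl h, fun _ h => by simp at h, fun _ _ => ?_,
          fun h => absurd h hwu, fun h => absurd h hwu⟩
        rcases i4 rfl rfl with h' | h' | h'
        · exact .inr (.inr ⟨hu, h'⟩)
        · exact .inl h'.2
        · exact absurd hu h'.2.1
      · refine .of_ne hwx hwu ?_
        rcases i4 rfl rfl with h' | h' | h'
        · exact h'.2.up hu (hHG (.inl hwx) (.inl hwu) e)
        · exact h'.2.back h'.1 (hHG (.inl hwx) (.inl hwu) ((h.parents w hwx hwu).2 e))
        · exact absurd hu h'.2.1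
    have hr := (i1 hux huy).up hu (hHG (.inr huy) (.inr hux) e)
    refine ⟨fun _ _ => hr, fun _ h => by simp at h, ?_, fun _ h => by simp at h, ?_⟩
    · rintro rfl -
      exact .inl hr
    · rintro rfl -
      exact hr

theorem exists_reach (h : CoveredReversal G H x y) {C : Finset V} {v u : V}
    (hr : ∃ b, Reach G C v b u) : ∃ b, Reach H C v b u := by
  obtain ⟨b, hb⟩ := hr
  obtain ⟨i1, i2, i3, i4, i5⟩ := h.simulated hb
  by_cases hux : u = x
  · subst hux
    cases b
    · rcases i3 rfl rfl with h' | h' | h'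
      · exact ⟨_, h'⟩
      · exact ⟨_, h'.2.down h'.1 h.adj'⟩
      · exact ⟨_, h'.2.1⟩
    · exact ⟨_, (i2 rfl rfl).1⟩
  by_cases huy : u = y
  · subst huy
    cases b
    · exact ⟨_, i5 rfl rfl⟩
    · rcases i4 rfl rfl with h' | h' | h'
      · exact ⟨_, h'.2⟩
      · exact ⟨_, h'.2.back h'.1 h.adj'⟩
      · exact ⟨_, h'.2.2⟩
  exact ⟨_, i1 hux huy⟩

theorem dConnected_iff (h : CoveredReversal G H x y) (hG : IsDAG G) {C : Finset V} {v w : V}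
    (hv : v ∉ C) : DConnected G v w C ↔ DConnected H v w C := by
  rw [dConnected_iff_reach hG hv, dConnected_iff_reach (h.isDAG hG) hv]
  exact ⟨h.exists_reach, h.symm.exists_reach⟩

end CoveredReversal

/-- `D` is a DAG with the same skeleton and the same v-structures as `G`. -/
structure SamePattern (G D : Digraph V) : Prop where
  isDAG : IsDAG D
  adj_or : ∀ a b, (D.Adj a b ∨ D.Adj b a) ↔ (G.Adj a b ∨ G.Adj b a)
  vStruct : ∀ a b c, VStruct D a b c ↔ VStruct G a b c

theorem SamePattern.refl {G : Digraph V} (hG : IsDAG G) : SamePattern G G :=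
  ⟨hG, fun _ _ => Iff.rfl, fun _ _ _ => Iff.rfl⟩

theorem SamePattern.nonAdjacent_iff {G D : Digraph V} (h : SamePattern G D) (a b : V) :
    NonAdjacent D a b ↔ NonAdjacent G a b :=
  nonAdjacent_congr (h.adj_or a b)

theorem coveredReversal_orient {G : Digraph V} (hG : IsDAG G) {x y : V} (e : G.Adj x y)
    (hp : ∀ q, q ≠ x → q ≠ y → (G.Adj q x ↔ G.Adj q y)) : CoveredReversal G (orient G y x) x y where
  adj := e
  not_adj := hG.asymm e
  adj' := .inl ⟨rfl, rfl⟩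
  not_adj' := by
    rintro (⟨rfl, -⟩ | h)
    · exact hG.irrefl _ e
    · exact h.2 ⟨rfl, rfl⟩
  other a b h1 h2 := ⟨fun h => .inr ⟨h, h1⟩, fun h => h.elim (fun h => absurd h h2) fun h => h.1⟩
  parents := hp
  loop := hG.irrefl _
  loop' := hG.irrefl _

variable [Fintype V]

theorem IsDAG.wf {G : Digraph V} (hG : IsDAG G) : WellFounded (Relation.TransGen G.Adj) :=
  have : IsTrans V (Relation.TransGen G.Adj) := ⟨fun _ _ _ => Relation.TransGen.trans⟩
  have : Std.Irrefl (Relation.TransGen G.Adj) := ⟨hG⟩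
  Finite.wellFounded_of_trans_of_irrefl _

theorem IsDAG.wf_flip {G : Digraph V} (hG : IsDAG G) :
    WellFounded (flip (Relation.TransGen G.Adj)) :=
  have : IsTrans V (flip (Relation.TransGen G.Adj)) := ⟨fun _ _ _ h h' => h'.trans h⟩
  have : Std.Irrefl (flip (Relation.TransGen G.Adj)) := ⟨hG⟩
  Finite.wellFounded_of_trans_of_irrefl _

/-- If two DAGs with the same skeleton and v-structures differ, then some edge on which they differ
is covered. -/
theorem SamePattern.exists_covered {G D : Digraph V} (hG : IsDAG G) (h : SamePattern G D)
    (hne : ∃ a b, G.Adj a b ∧ D.Adj b a) :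
    ∃ x y, G.Adj x y ∧ D.Adj y x ∧ ∀ q, q ≠ x → q ≠ y → (G.Adj q x ↔ G.Adj q y) := by
  obtain ⟨a, b, hab⟩ := hne
  -- `y` is the earliest head of a disagreeing edge, and `x` the latest tail among those ending in
  -- `y`. Hence `D` agrees with `G` on all edges into proper ancestors of `y`.
  obtain ⟨y, ⟨a, hya⟩, hy⟩ := hG.wf.has_min {y | ∃ x, G.Adj x y ∧ D.Adj y x} ⟨b, a, hab⟩
  obtain ⟨x, ⟨hxy, hyx⟩, hx⟩ := hG.wf_flip.has_min {x | G.Adj x y ∧ D.Adj y x} ⟨a, hya⟩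
  have hy' : ∀ z z', G.Adj z z' → Relation.TransGen G.Adj z' y → D.Adj z z' := by
    intro z z' e hz'
    refine ((h.adj_or z z').2 (.inl e)).resolve_right fun e' => ?_
    exact hy z' ⟨z, e, e'⟩ hz'
  refine ⟨x, y, hxy, hyx, fun q hqx hqy => ⟨fun e => ?_, fun e => ?_⟩⟩
  · have eD := hy' q x e (.single hxy)
    by_contra hn
    have hv : VStruct D q x y :=
      ⟨(h.nonAdjacent_iff q y).2 ⟨hqy, hn, hG.not_triangle e hxy⟩, eD, hyx⟩
    exact hG.asymm hxy ((h.vStruct q x y).1 hv).2.2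
  · by_contra hn
    have hxq : G.Adj x q := by
      by_contra hn'
      have hv : VStruct G x y q := ⟨⟨hqx.symm, hn', hn⟩, hxy, e⟩
      exact h.isDAG.asymm hyx ((h.vStruct x y q).2 hv).2.1
    have hD : D.Adj q y := by
      refine ((h.adj_or q y).2 (.inl e)).resolve_right fun e' => ?_
      exact hx q ⟨e, e'⟩ (.single hxq)
    exact h.isDAG.not_triangle hD hyx (hy' x q hxq (.single e))

-- Induction on the number of edges on which the graphs disagree: reversing a covered one in `G`
-- lowers it by at least one and keeps the skeleton, the v-structures and d-connection.
open Classical in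
theorem SamePattern.dConnected_iff {G D : Digraph V} (hG : IsDAG G) (h : SamePattern G D)
    {C : Finset V} {v w : V} (hv : v ∉ C) : DConnected G v w C ↔ DConnected D v w C := by
  induction hn : (Finset.univ.filter fun p : V × V => G.Adj p.1 p.2 ∧ D.Adj p.2 p.1).card using
    Nat.strong_induction_on generalizing G with
  | _ n ih =>
  subst hn
  by_cases hne : ∃ a b, G.Adj a b ∧ D.Adj b a
  · obtain ⟨x, y, hxy, hyx, hp⟩ := h.exists_covered hG hne
    have hc := coveredReversal_orient hG hxy hp
    rw [hc.dConnected_iff hG hv]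
    refine ih _ ?_ (hc.isDAG hG) ⟨h.isDAG, fun a b => ?_, fun a b c => ?_⟩ rfl
    · refine Finset.card_lt_card (Finset.ssubset_iff_of_subset ?_ |>.2 ⟨(x, y), ?_, ?_⟩)
      · rintro ⟨a, b⟩ hab
        simp only [Finset.mem_filter, Finset.mem_univ, true_and] at hab ⊢
        rcases hab.1 with ⟨rfl, rfl⟩ | h'
        · exact absurd hab.2 (h.isDAG.asymm hyx)
        · exact ⟨h'.1, hab.2⟩
      · simpa using ⟨hxy, hyx⟩
      · simp [hc.not_adj']
    · rw [h.adj_or, hc.adj_or]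
    · rw [h.vStruct, hc.vStruct_iff]
  · have hle : ∀ a b, G.Adj a b → D.Adj a b := fun a b e =>
      ((h.adj_or a b).2 (.inl e)).resolve_right fun e' => hne ⟨a, b, e, e'⟩
    have : G = D := by
      ext a b
      refine ⟨hle a b, fun e => ((h.adj_or a b).1 (.inl e)).resolve_right fun e' => ?_⟩
      exact h.isDAG.asymm e (hle b a e')
    rw [this]

end CoveredEdges

/-! ### Separating sets -/

section Separation

variable {V : Type*} {G : Digraph V}

theorem dConnected_of_adj (hG : IsDAG G) {a b : V} (h : G.Adj a b ∨ G.Adj b a) (C : Finset V) :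
    DConnected G a b C := by
  have hadj := hG.skeleton_adj.2 h
  refine ⟨.cons hadj .nil, by simp [hadj.ne], fun m hm => ?_⟩
  simp at hm

open Classical in
/-- The parents of `a` d-separate `a` from its non-adjacent non-descendants. -/
theorem not_dConnected_parents [Fintype V] (hG : IsDAG G) {a b : V} (hab : NonAdjacent G a b)
    (hr : ¬ Relation.TransGen G.Adj a b) :
    ¬ DConnected G a b (Finset.univ.filter fun q => G.Adj q a) := by
  rintro ⟨p, -, hp⟩
  have hadj : ∀ m < p.length, G.Adj (p.getVert m) (p.getVert (m + 1)) ∨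
      G.Adj (p.getVert (m + 1)) (p.getVert m) := fun m hm =>
    hG.skeleton_adj.1 (p.adj_getVert_succ hm)
  have h0 : p.length ≠ 0 := fun h => hab.1 (SimpleGraph.Walk.eq_of_length_eq_zero h)
  have h1 : p.length ≠ 1 := fun h => by
    have := hadj 0 (by omega)
    rw [zero_add, ← h, p.getVert_length, p.getVert_zero] at this
    exact this.elim hab.2.1 hab.2.2
  have key : ∀ k, k + 1 ≤ p.length → Relation.TransGen G.Adj a (p.getVert (k + 1)) ∧
      G.Adj (p.getVert k) (p.getVert (k + 1)) := by
    intro k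
    induction k with
    | zero =>
      intro _
      -- A path starting against an edge is blocked at once: its second vertex is a non-collider in
      -- the conditioning set.
      have e : G.Adj a (p.getVert 1) := by
        have h' := hadj 0 (by omega)
        rw [p.getVert_zero] at h'
        refine h'.resolve_right fun e => ?_
        refine (hp 0 (by omega)).2 (fun hc => ?_) (by simpa using e)
        rw [p.getVert_zero] at hc
        exact hG.asymm e hc.1
      rw [p.getVert_zero]
      exact ⟨.single e, e⟩
    | succ k ih =>
      intro hk
      obtain ⟨ih1, ih2⟩ := ih (by omega)
      -- An active collider here would be a descendant of `a` and an ancestor of a parent of `a`,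
      -- giving a cycle.
      have e := (hadj (k + 1) (by omega)).resolve_right fun e => by
        obtain ⟨d, hd, hkd⟩ := (hp k (by omega)).1 ⟨ih2, e⟩
        simp only [Finset.mem_filter, Finset.mem_univ, true_and] at hd
        exact hG a ((ih1.trans_left hkd).tail hd)
      exact ⟨ih1.tail e, e⟩
  obtain ⟨k, hk⟩ : ∃ k, p.length = k + 1 := ⟨p.length - 1, by omega⟩
  have := (key k hk.ge).1
  rw [← hk, p.getVert_length] at this
  exact hr this

/-- On an unshielded triple `a - b - c`, a separating set of `a` and `c` avoids `b` iff `b` is a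
collider. -/
theorem notMem_sepset_iff (hG : IsDAG G) {a b c : V} {C : Finset V}
    (hac : a ≠ c) (hab : G.Adj a b ∨ G.Adj b a) (hbc : G.Adj b c ∨ G.Adj c b)
    (hC : ¬ DConnected G a c C) : b ∉ C ↔ IsCollider G a b c := by
  have e1 := hG.skeleton_adj.2 hab
  have e2 := hG.skeleton_adj.2 hbc
  have hconn : (IsCollider G a b c → IsAncestorOf G b C) → (¬ IsCollider G a b c → b ∉ C) →
      DConnected G a c C := by
    intro h1 h2
    refine ⟨.cons e1 (.cons e2 .nil), by simp [e1.ne, e2.ne, hac], fun m hm => ?_⟩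
    obtain rfl : m = 0 := by simpa using hm
    exact ⟨h1, h2⟩
  constructor
  · intro hb
    by_contra hn
    exact hC (hconn (fun h => absurd h hn) fun _ => hb)
  · intro h hb
    exact hC (hconn (fun _ => ⟨b, hb, .refl⟩) fun h' => absurd h h')

theorem IsDAG.not_transGen_or (hG : IsDAG G) (a b : V) :
    ¬ Relation.TransGen G.Adj a b ∨ ¬ Relation.TransGen G.Adj b a := by
  by_contra! h
  exact hG a (h.1.trans h.2)

theorem dSeparates_singleton {a b : V} {C : Finset V} :
    DSeparates G {a} {b} C ↔ ¬ DConnected G a b C := by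
  simp [DSeparates]

-- By acyclicity one of the two vertices is not a descendant of the other, and the parents of that
-- other vertex separate. The disjunction avoids proving that d-connection is symmetric.
open Classical in
theorem exists_sepset [Fintype V] (hG : IsDAG G) {a b : V} (hab : NonAdjacent G a b) :
    ∃ C : Finset V, a ∉ C ∧ b ∉ C ∧ (¬ DConnected G a b C ∨ ¬ DConnected G b a C) := by
  rcases hG.not_transGen_or a b with h | h
  · exact ⟨_, by simpa using hG.irrefl a, by simpa using hab.2.2,
      .inl (not_dConnected_parents hG hab h)⟩
  · exact ⟨_, by simpa using hab.2.1, by simpa using hG.irrefl b,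
      .inr (not_dConnected_parents hG hab.symm h)⟩

end Separation

/-! ### The Markov equivalence class -/

section MarkovClass

variable {V : Type*} [Fintype V] {G : Digraph V}

/-- DAGs with the same d-separations between single vertices have the same skeleton and
v-structures. -/
theorem samePattern_of_dConnected_iff {D : Digraph V} (hG : IsDAG G) (hD : IsDAG D)
    (h : ∀ (C : Finset V) (a b : V), a ≠ b → a ∉ C → b ∉ C →
      (DConnected G a b C ↔ DConnected D a b C)) : SamePattern G D := by
  have hadj : ∀ {G D : Digraph V}, IsDAG G → IsDAG D →
      (∀ (C : Finset V) (a b : V), a ≠ b → a ∉ C → b ∉ C →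
        (DConnected G a b C ↔ DConnected D a b C)) →
      ∀ a b, G.Adj a b ∨ G.Adj b a → D.Adj a b ∨ D.Adj b a := by
    intro G D hG hD h a b hab
    have hne := (hG.skeleton_adj.2 hab).ne
    by_contra! hn
    obtain ⟨C, ha, hb, hC | hC⟩ := exists_sepset hD ⟨hne, hn⟩
    · exact hC ((h C a b hne ha hb).1 (dConnected_of_adj hG hab C))
    · exact hC ((h C b a hne.symm hb ha).1 (dConnected_of_adj hG hab.symm C))
  have h1 := hadj hG hD h
  have h2 := hadj hD hG fun C a b hab ha hb => (h C a b hab ha hb).symm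
  have hiff : ∀ a b, (D.Adj a b ∨ D.Adj b a) ↔ (G.Adj a b ∨ G.Adj b a) :=
    fun a b => ⟨h2 a b, h1 a b⟩
  refine ⟨hD, hiff, fun a b c => ?_⟩
  unfold VStruct
  rw [nonAdjacent_congr (hiff a c)]
  refine and_congr_right fun hac => ?_
  have key : ∀ a c, NonAdjacent G a c → ∀ C : Finset V, a ∉ C → c ∉ C → ¬ DConnected G a c C →
      (IsCollider D a b c ↔ IsCollider G a b c) := by
    intro a c hac C ha hc hC
    by_cases hab : G.Adj a b ∨ G.Adj b a
    · by_cases hbc : G.Adj b c ∨ G.Adj c b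
      · rw [← notMem_sepset_iff hG hac.1 hab hbc hC,
          ← notMem_sepset_iff hD hac.1 ((hiff a b).2 hab) ((hiff b c).2 hbc)
            fun h' => hC ((h C a c hac.1 ha hc).2 h')]
      · exact ⟨fun h => absurd ((hiff b c).1 (.inr h.2)) hbc, fun h => absurd (.inr h.2) hbc⟩
    · exact ⟨fun h => absurd ((hiff a b).1 (.inl h.1)) hab, fun h => absurd (.inl h.1) hab⟩
  obtain ⟨C, ha, hc, hC | hC⟩ := exists_sepset hG hac
  · exact key a c hac C ha hc hC
  · exact and_comm.trans ((key c a hac.symm C hc ha hC).trans and_comm)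

theorem SamePattern.faithful_iff {D : Digraph V} (hG : IsDAG G) (h : SamePattern G D)
    (P : Measure (V → ℝ)) [IsFiniteMeasure P] : Faithful P G ↔ Faithful P D := by
  unfold Faithful
  refine forall_congr' fun A => forall_congr' fun B => forall_congr' fun C =>
    forall_congr' fun _ => forall_congr' fun hAC => forall_congr' fun _ => iff_congr Iff.rfl ?_
  refine forall_congr' fun v => forall_congr' fun hv => forall_congr' fun w =>
    forall_congr' fun _ => not_congr ?_
  exact h.dConnected_iff hG (Finset.disjoint_left.1 hAC hv)

/-- Two DAGs, one of which has a faithful distribution, are Markov equivalent iff they have the same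
skeleton and v-structures. -/
theorem markovClass_eq (hG : IsDAG G) (P : Measure (V → ℝ)) [IsProbabilityMeasure P]
    (hP : Faithful P G) : markovClass G = {D | SamePattern G D} := by
  ext D
  constructor
  · rintro ⟨hD, hGD⟩
    -- The existence of a faithful `P` is essential here: its conditional independences are the
    -- d-separations of both graphs, which therefore coincide.
    have hPD := (hGD P).1 hP
    refine samePattern_of_dConnected_iff hG hD fun C a b hab ha hb => ?_
    have h1 := hP {a} {b} C (by simpa using hab) (by simpa using ha) (by simpa using hb)
    have h2 := hPD {a} {b} C (by simpa using hab) (by simpa using ha) (by simpa using hb)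
    rw [h1, dSeparates_singleton, dSeparates_singleton] at h2
    exact not_iff_not.1 h2
  · intro h
    exact ⟨h.isDAG, fun P _ => h.faithful_iff hG P⟩

end MarkovClass

/-! ### Perfect elimination orders -/

section Elimination

variable {V : Type*} (U : SimpleGraph V)

/-- The neighbours of `x` in `S` form a clique. -/
def Simplicial (S : Finset V) (x : V) : Prop :=
  ∀ y ∈ S, ∀ z ∈ S, U.Adj x y → U.Adj x z → y ≠ z → U.Adj y z

variable {U} [DecidableEq V]

/-- Dirac's theorem for graphs with a perfect elimination order: such a graph is complete or has two
non-adjacent simplicial vertices. -/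
theorem isClique_or_exists_simplicial
    (hU : ∀ S : Finset V, S.Nonempty → ∃ x ∈ S, Simplicial U S x) (S : Finset V) :
    U.IsClique (S : Set V) ∨ ∃ x ∈ S, ∃ y ∈ S, x ≠ y ∧ ¬ U.Adj x y ∧ Simplicial U S x ∧
      Simplicial U S y := by
  induction S using Finset.strongInduction with
  | H S ih =>
  rcases S.eq_empty_or_nonempty with rfl | hS
  · exact .inl (by simp)
  obtain ⟨s, hs, hsimp⟩ := hU S hS
  -- Putting `s` back cannot spoil a simplicial vertex that is not adjacent to `s`.
  have lift : ∀ x ∈ S, ¬ U.Adj s x → Simplicial U (S.erase s) x → Simplicial U S x := by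
    intro x _ hsx hx y hy z hz hxy hxz
    refine hx y (Finset.mem_erase.2 ⟨?_, hy⟩) z (Finset.mem_erase.2 ⟨?_, hz⟩) hxy hxz
    · rintro rfl
      exact hsx hxy.symm
    · rintro rfl
      exact hsx hxz.symm
  rcases ih _ (Finset.erase_ssubset hs) with h | ⟨x, hx, y, hy, hxy, hnxy, hsx, hsy⟩
  · by_cases hall : ∀ x ∈ S, x ≠ s → U.Adj s x
    · left
      intro a ha b hb hab
      by_cases has : a = s
      · subst has
        exact hall b hb hab.symm
      by_cases hbs : b = s
      · subst hbs
        exact (hall a ha hab).symm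
      exact h (by simpa using ⟨ha, has⟩) (by simpa using ⟨hb, hbs⟩) hab
    · push Not at hall
      obtain ⟨x, hx, hxs, hsx⟩ := hall
      refine .inr ⟨s, hs, x, hx, hxs.symm, hsx, hsimp, lift x hx hsx ?_⟩
      exact fun y hy z hz _ _ hyz => h hy hz hyz
  · obtain ⟨hxs, hxS⟩ := Finset.mem_erase.1 hx
    obtain ⟨hys, hyS⟩ := Finset.mem_erase.1 hy
    by_cases h1 : U.Adj s x
    · have h2 : ¬ U.Adj s y := fun h2 => hnxy (hsimp x hxS y hyS h1 h2 hxy)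
      exact .inr ⟨s, hs, y, hyS, hys.symm, h2, hsimp, lift y hyS h2 hsy⟩
    · exact .inr ⟨s, hs, x, hxS, hxs.symm, h1, hsimp, lift x hxS h1 hsx⟩

theorem exists_simplicial_ne (hU : ∀ S : Finset V, S.Nonempty → ∃ x ∈ S, Simplicial U S x)
    {S : Finset V} {u w : V} (hw : w ∈ S) (hwu : w ≠ u) : ∃ x ∈ S, x ≠ u ∧ Simplicial U S x := by
  rcases isClique_or_exists_simplicial hU S with h | ⟨x, hx, y, hy, hxy, -, hsx, hsy⟩
  · exact ⟨w, hw, hwu, fun y hy z hz _ _ hyz => h hy hz hyz⟩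
  · by_cases hxu : x = u
    · exact ⟨y, hy, fun hyu => hxy (hxu.trans hyu.symm), hsy⟩
    · exact ⟨x, hx, hxu, hsx⟩

/-- A perfect elimination order may be chosen to end in any given vertex. -/
theorem exists_elimination_order
    (hU : ∀ S : Finset V, S.Nonempty → ∃ x ∈ S, Simplicial U S x) (u : V) (S : Finset V) :
    ∃ r : V → ℕ, (∀ x ∈ S, x ≠ u → r x < r u) ∧ Set.InjOn r S ∧
      ∀ x ∈ S, ∀ y ∈ S, ∀ z ∈ S, U.Adj x y → U.Adj x z → r x < r y → r x < r z → y ≠ z →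
        U.Adj y z := by
  induction S using Finset.strongInduction with
  | H S ih =>
  by_cases hS : ∃ w ∈ S, w ≠ u
  · obtain ⟨w, hw, hwu⟩ := hS
    obtain ⟨x, hx, hxu, hsx⟩ := exists_simplicial_ne hU hw hwu
    obtain ⟨r, h1, h2, h3⟩ := ih _ (Finset.erase_ssubset hx)
    -- The simplicial `x` is eliminated first, and the order of the remaining vertices is shifted up
    -- by one.
    refine ⟨fun z => if z = x then 0 else r z + 1, fun a ha hau => ?_, fun a ha b hb hab => ?_,
      fun a ha b hb c hc hab hac h h' hbc => ?_⟩
    · by_cases hax : a = x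
      · simp [hax, hxu.symm]
      · simpa [hax, hxu.symm] using h1 a (by simp [hax, ha]) hau
    · by_cases hax : a = x <;> by_cases hbx : b = x
      · rw [hax, hbx]
      · simp [hax, hbx] at hab
      · simp [hax, hbx] at hab
      · exact h2 (by simpa using ⟨ha, hax⟩) (by simpa using ⟨hb, hbx⟩) (by simpa [hax, hbx] using hab)
    · by_cases hax : a = x
      · subst hax
        exact hsx b hb c hc hab hac hbc
      · have hbx : b ≠ x := by rintro rfl; simp at h
        have hcx : c ≠ x := by rintro rfl; simp at h'
        exact h3 a (by simp [hax, ha]) b (by simp [hbx, hb]) c (by simp [hcx, hc]) hab hac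
          (by simpa [hax, hbx] using h) (by simpa [hax, hcx] using h') hbc
  · push Not at hS
    refine ⟨fun _ => 0, fun x hx hxu => absurd (hS x hx) hxu, fun a ha b hb _ => ?_, ?_⟩
    · rw [hS a ha, hS b hb]
    · intro x _ y _ z _ _ _ h
      exact absurd h (lt_irrefl _)

end Elimination

/-! ### Soundness and completeness of the orientation rules -/

section OrientationRules

variable {V : Type*} {G : Digraph V}

theorem orient_adj_iff {E : Digraph V} {u v : V} (h : E.Adj u v) (huv : u ≠ v) (a b : V) :
    (orient E u v).Adj a b ↔ E.Adj a b ∧ ¬ (a = v ∧ b = u) := by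
  constructor
  · rintro (⟨rfl, rfl⟩ | h')
    · exact ⟨h, fun h' => huv h'.1⟩
    · exact h'
  · exact fun h' => .inr h'

/-- The undirected skeleton of `G` with exactly the edges of v-structures directed. -/
def pattern (G : Digraph V) : Digraph V where
  Adj a b := (G.Adj a b ∨ G.Adj b a) ∧ ¬ ∃ c, VStruct G b a c

/-- `E` has the skeleton of `G`, its v-structures are directed, and all its directed edges are
common to the DAGs with the skeleton and v-structures of `G`. -/
structure Sound (G E : Digraph V) : Prop where
  le : ∀ D, SamePattern G D → ∀ a b, D.Adj a b → E.Adj a b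
  adj_or : ∀ a b, E.Adj a b → G.Adj a b ∨ G.Adj b a
  vStruct : ∀ a b c, VStruct G a b c → ¬ E.Adj b a

namespace Sound

theorem pattern (G : Digraph V) : Sound G (pattern G) where
  le D hD a b h := by
    refine ⟨(hD.adj_or a b).1 (.inl h), ?_⟩
    rintro ⟨c, hc⟩
    exact hD.isDAG.asymm h ((hD.vStruct _ _ _).2 hc).2.1
  adj_or a b h := h.1
  vStruct a b c h h' := h'.2 ⟨c, h⟩

variable {E F : Digraph V}

theorem adj_or_iff (hG : IsDAG G) (h : Sound G E) (a b : V) :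
    (E.Adj a b ∨ E.Adj b a) ↔ (G.Adj a b ∨ G.Adj b a) := by
  refine ⟨fun h' => h'.elim (h.adj_or a b) fun h' => (h.adj_or b a h').symm, fun h' => ?_⟩
  exact h'.imp (h.le G (.refl hG) a b) (h.le G (.refl hG) b a)

theorem nonAdjacent_iff (hG : IsDAG G) (h : Sound G E) (a b : V) :
    NonAdjacent E a b ↔ NonAdjacent G a b :=
  nonAdjacent_congr (h.adj_or_iff hG a b)

theorem adj_of_dirEdge (h : Sound G E) {D : Digraph V} (hD : SamePattern G D) {a b : V}
    (hab : DirEdge E a b) : D.Adj a b :=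
  ((hD.adj_or a b).2 (h.adj_or a b hab.1)).resolve_right fun h' => hab.2 (h.le D hD b a h')

theorem trichotomy (hG : IsDAG G) (h : Sound G E) {a b : V} (hab : G.Adj a b ∨ G.Adj b a) :
    DirEdge E a b ∨ DirEdge E b a ∨ UndirEdge E a b := by
  have := (h.adj_or_iff hG a b).2 hab
  unfold DirEdge UndirEdge
  tauto

theorem ne (hG : IsDAG G) (h : Sound G E) {a b : V} (hab : E.Adj a b) : a ≠ b := by
  rcases h.adj_or a b hab with h | h
  · exact hG.ne h
  · exact (hG.ne h).symm

/-- The orientation rules are sound. -/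
theorem adj_of_ruleApplies (hG : IsDAG G) (h : Sound G E) {D : Digraph V} (hD : SamePattern G D)
    {i j : V} (hij : RuleApplies E i j) : D.Adj i j := by
  obtain ⟨hu, hr⟩ := hij
  refine ((hD.adj_or i j).2 (h.adj_or i j hu.1)).resolve_right fun hji => ?_
  have dir : ∀ {a b}, DirEdge E a b → D.Adj a b := fun h' => h.adj_of_dirEdge hD h'
  have not_v : ∀ {a b c}, NonAdjacent E a c → D.Adj a b → D.Adj c b → ¬ E.Adj b a := by
    intro a b c hn h1 h2
    refine h.vStruct a b c ((hD.vStruct a b c).1 ⟨?_, h1, h2⟩)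
    rwa [hD.nonAdjacent_iff, ← h.nonAdjacent_iff hG]
  have flip : ∀ {a b}, E.Adj a b → ¬ D.Adj a b → D.Adj b a := fun h1 h2 =>
    ((hD.adj_or _ _).2 (h.adj_or _ _ h1)).resolve_left h2
  rcases hr with ⟨c, hci, hn⟩ | ⟨c, hic, hcj⟩ | ⟨c, d, hic, hcj, hid, hdj, hn⟩ |
    ⟨c, d, hic, hcd, hdj, hn⟩
  · exact not_v hn.symm hji (dir hci) hu.1
  · exact hD.isDAG.not_triangle (dir hic) (dir hcj) hji
  · exact not_v hn (flip hic.1 fun h' => hD.isDAG.not_triangle h' (dir hcj) hji)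
      (flip hid.1 fun h' => hD.isDAG.not_triangle h' (dir hdj) hji) hic.1
  · have hic' : D.Adj i c := by
      by_contra h'
      exact not_v hn (flip hic.1 h') hji hic.1
    exact hD.isDAG i (.tail (.tail (.tail (.single hic') (dir hcd)) (dir hdj)) hji)

theorem orient_iff (hG : IsDAG G) (h : Sound G E) {i j : V} (hij : RuleApplies E i j) (a b : V) :
    (orient E i j).Adj a b ↔ E.Adj a b ∧ ¬ (a = j ∧ b = i) :=
  orient_adj_iff hij.1.1 (h.ne hG hij.1.1) a b

theorem orient (hG : IsDAG G) (h : Sound G E) {i j : V} (hij : RuleApplies E i j) :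
    Sound G (orient E i j) where
  le D hD a b hab := by
    rw [h.orient_iff hG hij]
    refine ⟨h.le D hD a b hab, ?_⟩
    rintro ⟨rfl, rfl⟩
    exact hD.isDAG.asymm hab (h.adj_of_ruleApplies hG hD hij)
  adj_or a b hab := h.adj_or a b ((h.orient_iff hG hij a b).1 hab).1
  vStruct a b c hv hba := h.vStruct a b c hv ((h.orient_iff hG hij b a).1 hba).1

theorem of_reflTransGen (hG : IsDAG G) (h : Sound G E)
    (hEF : Relation.ReflTransGen RuleStep E F) : Sound G F ∧ ∀ a b, F.Adj a b → E.Adj a b := by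
  induction hEF with
  | refl => exact ⟨h, fun _ _ => id⟩
  | tail _ hst ih =>
    obtain ⟨i, j, hij, rfl⟩ := hst
    exact ⟨ih.1.orient hG hij, fun a b hab => ih.2 a b ((ih.1.orient_iff hG hij a b).1 hab).1⟩

theorem dirEdge_mono (hG : IsDAG G) (hE : Sound G E) (hF : Sound G F)
    (hFE : ∀ a b, F.Adj a b → E.Adj a b) {a b : V} (h : DirEdge E a b) : DirEdge F a b :=
  ⟨hF.le G (.refl hG) a b (hE.adj_of_dirEdge (.refl hG) h), fun h' => h.2 (hFE _ _ h')⟩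

/-- R1 forces `a` and `c` to be adjacent, and R2 excludes `c → a`, since `c → a → b` would orient `c
- b`. -/
theorem dirEdge_or_undirEdge (hG : IsDAG G) (hF : Sound G F) (hfin : ∀ i j, ¬ RuleApplies F i j)
    {a b c : V} (hab : DirEdge F a b) (hbc : UndirEdge F b c) :
    DirEdge F a c ∨ UndirEdge F a c := by
  have hac : a ≠ c := by rintro rfl; exact hab.2 hbc.1
  by_cases hn : NonAdjacent F a c
  · exact absurd ⟨hbc, .inl ⟨a, hab, hn⟩⟩ (hfin b c)
  · have hadj : G.Adj a c ∨ G.Adj c a := by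
      rw [← hF.adj_or_iff hG]
      unfold NonAdjacent at hn
      tauto
    rcases hF.trichotomy hG hadj with h | h | h
    · exact .inl h
    · exact absurd ⟨⟨hbc.2, hbc.1⟩, .inr (.inl ⟨a, h, hab⟩)⟩ (hfin c b)
    · exact .inr h

/-- Let `a → b ← d` be the v-structure and suppose `a - c`. Then `d → c` would let R1 orient `c →
a`, and `d - c` would let R3 orient `c → b`. -/
theorem dirEdge_of_pattern (hG : IsDAG G) (hF : Sound G F) (hfin : ∀ i j, ¬ RuleApplies F i j)
    {a b c : V} (hab : DirEdge (PCAlg.pattern G) a b) (hbc : UndirEdge F b c) : DirEdge F a c := by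
  obtain ⟨d, hd⟩ : ∃ d, VStruct G a b d := by
    by_contra hn
    exact hab.2 ⟨hab.1.1.symm, hn⟩
  have dir : ∀ {a d}, VStruct G a b d → DirEdge F a b := fun hv =>
    ⟨hF.le G (.refl hG) _ _ hv.2.1, hF.vStruct _ _ _ hv⟩
  have hn : NonAdjacent F a d := (hF.nonAdjacent_iff hG a d).2 hd.1
  refine (hF.dirEdge_or_undirEdge hG hfin (dir hd) hbc).resolve_right fun hac => ?_
  rcases hF.dirEdge_or_undirEdge hG hfin (dir hd.symm) hbc with h | h
  · exact hfin c a ⟨⟨hac.2, hac.1⟩, .inl ⟨d, h, hn.symm⟩⟩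
  · exact hfin c b ⟨⟨hbc.2, hbc.1⟩, .inr (.inr (.inl
      ⟨a, d, ⟨hac.2, hac.1⟩, dir hd, ⟨h.2, h.1⟩, dir hd.symm, hn⟩))⟩

/-- Suppose `a - c`. The hypothesis `hP` transfers to `c` the arrows into `b` in the premises of R2,
R3 and R4; for R1 it transfers the arrow into `a`. In each case some rule still applies in `F`, or a
cycle or a v-structure with an undirected edge appears. -/
theorem dirEdge_of_ruleApplies (hG : IsDAG G) (hE : Sound G E) (hF : Sound G F)
    (hFE : ∀ a b, F.Adj a b → E.Adj a b) (hfin : ∀ i j, ¬ RuleApplies F i j)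
    (hP : ∀ a b c, DirEdge E a b → UndirEdge F b c → DirEdge F a c) {a b c : V}
    (hr : RuleApplies E a b) (hab : DirEdge F a b) (hbc : UndirEdge F b c) : DirEdge F a c := by
  refine (hF.dirEdge_or_undirEdge hG hfin hab hbc).resolve_right fun hac => ?_
  have dir : ∀ {a b}, DirEdge E a b → DirEdge F a b := fun h => hE.dirEdge_mono hG hF hFE h
  have dirG : ∀ {a b}, DirEdge F a b → G.Adj a b := fun h => hF.adj_of_dirEdge (.refl hG) h
  have non : ∀ {a b}, NonAdjacent E a b → NonAdjacent F a b := fun h =>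
    (hF.nonAdjacent_iff hG _ _).2 ((hE.nonAdjacent_iff hG _ _).1 h)
  have hcb : UndirEdge F c b := ⟨hbc.2, hbc.1⟩
  have hca : UndirEdge F c a := ⟨hac.2, hac.1⟩
  have R1 : ∀ {a b c}, DirEdge F a b → UndirEdge F b c → NonAdjacent F a c → False :=
    fun h1 h2 h3 => hfin _ _ ⟨h2, .inl ⟨_, h1, h3⟩⟩
  have R2 : ∀ {a b c}, DirEdge F a b → DirEdge F b c → UndirEdge F a c → False :=
    fun h1 h2 h3 => hfin _ _ ⟨h3, .inr (.inl ⟨_, h1, h2⟩)⟩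
  rcases hr.2 with ⟨d, hda, hn⟩ | ⟨d, had, hdb⟩ | ⟨d, e, had, hdb, hae, heb, hn⟩ |
    ⟨d, e, had, hde, heb, hn⟩
  · exact R1 (hP d a c hda hac) hcb (non hn)
  · exact R2 (dir had) (hP d b c hdb hbc) hac
  · have hdc := hP d b c hdb hbc
    have hec := hP e b c heb hbc
    rcases hF.trichotomy hG (hE.adj_or a d had.1) with h | h | h
    · exact R2 h hdc hac
    · rcases hF.trichotomy hG (hE.adj_or a e hae.1) with h' | h' | h'
      · exact R2 h' hec hac
      · exact hE.vStruct d a e ⟨(hE.nonAdjacent_iff hG d e).1 hn, dirG h, dirG h'⟩ had.1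
      · exact R1 h h' (non hn)
    · rcases hF.trichotomy hG (hE.adj_or a e hae.1) with h' | h' | h'
      · exact R2 h' hec hac
      · exact R1 h' h (non hn.symm)
      · exact hfin a c ⟨hac, .inr (.inr (.inl ⟨d, e, h, hdc, h', hec, non hn⟩))⟩
  · have hec := hP e b c heb hbc
    by_cases hdc : NonAdjacent F d c
    · rcases hF.trichotomy hG (hE.adj_or a d had.1) with h | h | h
      · by_cases hea : NonAdjacent F e a
        · exact R1 hec hca hea
        · have hne : e ≠ a := by
            rintro rfl
            exact hG.asymm (dirG h) (dirG (dir hde))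
          have hadj : G.Adj a e ∨ G.Adj e a := by
            rw [← hF.adj_or_iff hG]
            unfold NonAdjacent at hea
            tauto
          rcases hF.trichotomy hG hadj with h' | h' | h'
          · exact R2 h' hec hac
          · exact hG.not_triangle (dirG h) (dirG (dir hde)) (dirG h')
          · exact R2 h (dir hde) h'
      · exact R1 h hac hdc
      · exact hfin a c ⟨hac, .inr (.inr (.inr ⟨d, e, h, dir hde, hec, hdc⟩))⟩
    · have hne : d ≠ c := by
        rintro rfl
        exact (non hn).2.2 hbc.1
      have hadj : G.Adj d c ∨ G.Adj c d := by
        rw [← hF.adj_or_iff hG]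
        unfold NonAdjacent at hdc
        tauto
      rcases hF.trichotomy hG hadj with h | h | h
      · exact R1 h hcb (non hn)
      · exact hG.not_triangle (dirG h) (dirG (dir hde)) (dirG hec)
      · exact R2 (dir hde) hec h

/-- In the final graph, `a → b - c` implies `a → c`. -/
theorem dirEdge_trans (hG : IsDAG G) (hF : Relation.ReflTransGen RuleStep (PCAlg.pattern G) F)
    (hfin : ∀ i j, ¬ RuleApplies F i j) {a b c : V} (hab : DirEdge F a b) (hbc : UndirEdge F b c) :
    DirEdge F a c := by
  have hFs := ((Sound.pattern G).of_reflTransGen hG hF).1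
  -- The induction runs over the stage at which `a → b` was oriented, while `b - c` and the
  -- conclusion always refer to the final graph.
  have key : ∀ E, Relation.ReflTransGen RuleStep (PCAlg.pattern G) E →
      Relation.ReflTransGen RuleStep E F →
      ∀ a b c, DirEdge E a b → UndirEdge F b c → DirEdge F a c := by
    intro E hE
    induction hE with
    | refl => exact fun _ a b c => hFs.dirEdge_of_pattern hG hfin
    | @tail E E' hE hst ih =>
      intro hE'F a b c hab hbc
      have ih := ih (.head hst hE'F)
      have hEs := ((Sound.pattern G).of_reflTransGen hG hE).1
      obtain ⟨-, hFE⟩ := hEs.of_reflTransGen hG (.head hst hE'F)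
      obtain ⟨i, j, hij, rfl⟩ := hst
      have hEs' := hEs.orient hG hij
      obtain ⟨-, hFE'⟩ := hEs'.of_reflTransGen hG hE'F
      have hab' := hEs'.dirEdge_mono hG hFs hFE' hab
      by_cases h : a = i ∧ b = j
      · obtain ⟨rfl, rfl⟩ := h
        exact hEs.dirEdge_of_ruleApplies hG hFs hFE hfin ih hij hab' hbc
      · refine ih a b c ⟨((hEs.orient_iff hG hij a b).1 hab.1).1, fun h' => hab.2 ?_⟩ hbc
        exact (hEs.orient_iff hG hij b a).2 ⟨h', fun h'' => h ⟨h''.2, h''.1⟩⟩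
  exact key F hF .refl a b c hab hbc

end Sound

/-- The undirected part of a graph. -/
def undirectedPart (E : Digraph V) : SimpleGraph V where
  Adj a b := a ≠ b ∧ UndirEdge E a b
  symm := ⟨fun _ _ h => ⟨h.1.symm, h.2.2, h.2.1⟩⟩
  loopless := ⟨fun _ h => h.1 rfl⟩

/-- Orient the undirected edges of `E` downwards along `r`. -/
def orientBy (E : Digraph V) (r : V → ℕ) : Digraph V where
  Adj a b := DirEdge E a b ∨ (UndirEdge E a b ∧ r b < r a)

/-! ### Extending a closed graph to a DAG -/

section Extension

variable {F : Digraph V} (hG : IsDAG G) (hF : Sound G F)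
  (htrans : ∀ a b c, DirEdge F a b → UndirEdge F b c → DirEdge F a c)

include hG hF htrans

theorem undirEdge_of_parents {x y z : V} (hxy : UndirEdge F x y) (hxz : UndirEdge F x z)
    (hadj : ¬ NonAdjacent F y z) (hne : y ≠ z) : UndirEdge F y z := by
  have h : G.Adj y z ∨ G.Adj z y := by
    rw [← hF.adj_or_iff hG]
    unfold NonAdjacent at hadj
    tauto
  rcases hF.trichotomy hG h with h | h | h
  · exact absurd hxy.1 (htrans y z x h ⟨hxz.2, hxz.1⟩).2
  · exact absurd hxz.1 (htrans z y x h ⟨hxy.2, hxy.1⟩).2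
  · exact h

/-- Take `x` in `S` without proper descendants in `S`. Its undirected neighbours in `S` are parents
of `x` in `G`; two non-adjacent ones would form a v-structure, whose edges are directed in `F`. -/
theorem exists_simplicial_undirectedPart [Fintype V] (S : Finset V) (hS : S.Nonempty) :
    ∃ x ∈ S, Simplicial (undirectedPart F) S x := by
  obtain ⟨x, hx, hmin⟩ := hG.wf_flip.has_min (S : Set V) hS
  refine ⟨x, hx, fun y hy z hz hxy hxz hyz => ⟨hyz, ?_⟩⟩
  have hp : ∀ {y}, y ∈ S → UndirEdge F x y → G.Adj y x := fun hy h =>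
    (hF.adj_or x _ h.1).resolve_left fun h' => hmin _ hy (.single h')
  refine undirEdge_of_parents hG hF htrans hxy.2 hxz.2 (fun hn => ?_) hyz
  exact hF.vStruct y x z ⟨(hF.nonAdjacent_iff hG y z).1 hn, hp hy hxy.2, hp hz hxz.2⟩ hxy.2.1

/-- A cycle of formerly undirected edges contradicts the decrease of `r`. On any other cycle
`htrans` lets a directed edge absorb the undirected ones after it, leaving a cycle in `G`. -/
theorem isDAG_orientBy (r : V → ℕ) : IsDAG (orientBy F r) := by
  intro v hv
  have split : ∀ {v w}, Relation.TransGen (orientBy F r).Adj v w →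
      r w < r v ∨ ∃ a b, Relation.ReflTransGen (orientBy F r).Adj v a ∧ DirEdge F a b ∧
        Relation.ReflTransGen (orientBy F r).Adj b w := by
    intro v w h
    induction h with
    | single h =>
      rcases h with h | h
      · exact .inr ⟨_, _, .refl, h, .refl⟩
      · exact .inl h.2
    | tail hvb hbc ih =>
      rcases ih with ih | ⟨a, b, h1, h2, h3⟩
      · rcases hbc with h | h
        · exact .inr ⟨_, _, hvb.to_reflTransGen, h, .refl⟩
        · exact .inl (h.2.trans ih)
      · exact .inr ⟨a, b, h1, h2, h3.tail hbc⟩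
  have push : ∀ {a b c}, DirEdge F a b → Relation.ReflTransGen (orientBy F r).Adj b c →
      ∃ c', Relation.ReflTransGen G.Adj a c' ∧ DirEdge F c' c := by
    intro a b c hab h
    induction h with
    | refl => exact ⟨a, .refl, hab⟩
    | tail _ hcd ih =>
      obtain ⟨c', h1, h2⟩ := ih
      rcases hcd with h | h
      · exact ⟨_, h1.tail (hF.adj_of_dirEdge (.refl hG) h2), h⟩
      · exact ⟨c', h1, htrans _ _ _ h2 h.1⟩
  rcases split hv with h | ⟨a, b, h1, h2, h3⟩
  · exact lt_irrefl _ h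
  · obtain ⟨c, h4, h5⟩ := push h2 (h3.trans h1)
    exact hG a (.tail' h4 (hF.adj_of_dirEdge (.refl hG) h5))

/-- No new v-structure arises: two parents along undirected edges are adjacent by `hr`, and a mixed
pair is adjacent by `htrans`. -/
theorem samePattern_orientBy {r : V → ℕ} (hinj : Function.Injective r)
    (hr : ∀ x y z, UndirEdge F x y → UndirEdge F x z → r x < r y → r x < r z → y ≠ z →
      UndirEdge F y z) : SamePattern G (orientBy F r) := by
  have hadj : ∀ a b, ((orientBy F r).Adj a b ∨ (orientBy F r).Adj b a) ↔
      (G.Adj a b ∨ G.Adj b a) := by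
    intro a b
    rw [← hF.adj_or_iff hG]
    constructor
    · rintro ((h | h) | (h | h))
      · exact .inl h.1
      · exact .inl h.1.1
      · exact .inr h.1
      · exact .inl h.1.2
    · intro h
      have hab : r a ≠ r b := fun h' => by
        obtain rfl := hinj h'
        exact h.elim (fun h => hF.ne hG h rfl) fun h => hF.ne hG h rfl
      rcases hF.trichotomy hG ((hF.adj_or_iff hG a b).1 h) with h | h | h
      · exact .inl (.inl h)
      · exact .inr (.inl h)
      · rcases lt_or_gt_of_ne hab with h' | h'
        · exact .inr (.inr ⟨⟨h.2, h.1⟩, h'⟩)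
        · exact .inl (.inr ⟨h, h'⟩)
  refine ⟨isDAG_orientBy hG hF htrans r, hadj, fun a b c => ⟨?_, fun hv => ?_⟩⟩
  · rintro ⟨hn, hab, hcb⟩
    have hn' : NonAdjacent G a c := (nonAdjacent_congr (hadj a c)).1 hn
    have hnF : NonAdjacent F a c := (hF.nonAdjacent_iff hG a c).2 hn'
    rcases hab with hab | hab <;> rcases hcb with hcb | hcb
    · exact ⟨hn', hF.adj_of_dirEdge (.refl hG) hab, hF.adj_of_dirEdge (.refl hG) hcb⟩
    · exact absurd (htrans a b c hab ⟨hcb.1.2, hcb.1.1⟩).1 hnF.2.1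
    · exact absurd (htrans c b a hcb ⟨hab.1.2, hab.1.1⟩).1 hnF.2.2
    · exact absurd (hr b a c ⟨hab.1.2, hab.1.1⟩ ⟨hcb.1.2, hcb.1.1⟩ hab.2 hcb.2 hn.1).1 hnF.2.1
  · have dir : ∀ {a c}, VStruct G a b c → (orientBy F r).Adj a b := fun hv =>
      .inl ⟨hF.le G (.refl hG) _ _ hv.2.1, hF.vStruct _ _ _ hv⟩
    exact ⟨(nonAdjacent_congr (hadj a c)).2 hv.1, dir hv, dir hv.symm⟩

/-- Completeness of the orientation rules: an undirected edge of the final graph is oriented either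
way by some DAG with the same skeleton and v-structures. -/
theorem exists_samePattern_adj [Fintype V] {u v : V} (huv : UndirEdge F u v) :
    ∃ D, SamePattern G D ∧ D.Adj u v := by
  classical
  obtain ⟨r, h1, h2, h3⟩ := exists_elimination_order
    (exists_simplicial_undirectedPart hG hF htrans) u Finset.univ
  have hne := hF.ne hG huv.1
  refine ⟨orientBy F r, samePattern_orientBy hG hF htrans (fun a b h => ?_) ?_,
    .inr ⟨huv, h1 v (Finset.mem_univ _) hne.symm⟩⟩
  · exact h2 (by simp) (by simp) h
  · intro x y z hxy hxz h h' hyz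
    exact (h3 x (Finset.mem_univ _) y (Finset.mem_univ _) z (Finset.mem_univ _)
      ⟨hF.ne hG hxy.1, hxy⟩ ⟨hF.ne hG hxz.1, hxz⟩ h h' hyz).2

end Extension

/-- The orientation rules turn the pattern of `G` into its CPDAG. -/
theorem eq_cpdag [Fintype V] {F : Digraph V} (hG : IsDAG G)
    (hcl : markovClass G = {D | SamePattern G D})
    (hF : Relation.ReflTransGen RuleStep (pattern G) F) (hfin : ∀ i j, ¬ RuleApplies F i j) :
    F = cpdag G := by
  have hFs := ((Sound.pattern G).of_reflTransGen hG hF).1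
  have htrans : ∀ a b c, DirEdge F a b → UndirEdge F b c → DirEdge F a c := fun a b c =>
    Sound.dirEdge_trans hG hF hfin
  ext u v
  simp only [cpdag, hcl, Set.mem_ofPred_eq]
  constructor
  · intro h
    by_cases h' : F.Adj v u
    · exact .inr ⟨exists_samePattern_adj hG hFs htrans ⟨h, h'⟩,
        exists_samePattern_adj hG hFs htrans ⟨h', h⟩⟩
    · exact .inl fun D hD => hFs.adj_of_dirEdge hD ⟨h, h'⟩
  · rintro (h | ⟨⟨D, hD, h⟩, -⟩)
    · exact hFs.le G (.refl hG) u v (h G (.refl hG))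
    · exact hFs.le D hD u v h

/-- The orientation phase terminates. -/
theorem exists_ruleStep_final [Fintype V] (hG : IsDAG G) {E : Digraph V} (hE : Sound G E) :
    ∃ F, Relation.ReflTransGen RuleStep E F ∧ ∀ i j, ¬ RuleApplies F i j := by
  classical
  induction hn : (Finset.univ.filter fun p : V × V => E.Adj p.1 p.2).card using
    Nat.strong_induction_on generalizing E with
  | _ n ih =>
  subst hn
  by_cases h : ∃ i j, RuleApplies E i j
  · obtain ⟨i, j, hij⟩ := h
    have hlt : (Finset.univ.filter fun p : V × V => (orient E i j).Adj p.1 p.2) ⊂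
        Finset.univ.filter fun p : V × V => E.Adj p.1 p.2 := by
      refine (Finset.ssubset_iff_of_subset fun p hp => ?_).2 ⟨(j, i), ?_, ?_⟩
      · simp only [Finset.mem_filter, Finset.mem_univ, true_and, hE.orient_iff hG hij] at hp ⊢
        exact hp.1
      · simpa using hij.1.2
      · simp [hE.orient_iff hG hij]
    obtain ⟨F, hF, hfin⟩ := ih _ (Finset.card_lt_card hlt) (hE.orient hG hij) rfl
    exact ⟨F, .head ⟨i, j, hij, rfl⟩ hF, hfin⟩
  · push Not at h
    exact ⟨E, .refl, h⟩

end OrientationRules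

/-! ### The skeleton search with a d-separation oracle -/

section SkeletonSearch

variable {V : Type*} {G : Digraph V} {accept : V → V → Finset V → Prop}

theorem SkelState.Candidate.notMem {s : SkelState V} {i j : V} {k : Finset V}
    (h : s.Candidate i j k) : i ∉ k ∧ j ∉ k :=
  ⟨fun hi => s.skel.loopless.irrefl i (h.1 hi).1, fun hj => (h.1 hj).2 rfl⟩

/-- Invariant of the skeleton search with an oracle for d-separation in `G`. -/
structure SkelInv (G : Digraph V) (accept : V → V → Finset V → Prop) (s : SkelState V) : Prop where
  le : ∀ a b, G.Adj a b ∨ G.Adj b a → s.skel.Adj a b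
  sep : ∀ a b, a ≠ b → ¬ s.skel.Adj a b →
    ¬ DConnected G a b (s.sep a b) ∨ ¬ DConnected G b a (s.sep a b)
  rej : ∀ i j (k : Finset V), s.skel.Adj i j → (k : Set V) ⊆ s.nbrs i j →
    (k.card < s.level ∨ (k.card = s.level ∧ (i, j) ∈ s.done)) → ¬ accept i j k

theorem SkelInv.init (hG : IsDAG G) : SkelInv G accept (SkelState.init V) where
  le a b h := (hG.skeleton_adj.2 h).ne
  sep a b hab h := absurd hab h
  rej i j k _ _ h := by
    rcases h with h | h
    · exact absurd h (Nat.not_lt_zero _)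
    · exact absurd h.2 (Set.notMem_empty _)

variable [Fintype V]

theorem SkelState.card_le_ncard {s : SkelState V} {i j : V} {k : Finset V}
    (h : (k : Set V) ⊆ s.nbrs i j) : k.card ≤ (s.nbrs i j).ncard := by
  rw [← Set.ncard_coe_finset]
  exact Set.ncard_le_ncard h (Set.toFinite _)

/-- The skeleton search finds the skeleton. -/
theorem SkelInv.adj_iff (hG : IsDAG G)
    (hacc : ∀ i j k, i ≠ j → i ∉ k → j ∉ k → (accept i j k ↔ ¬ DConnected G i j k))
    {s : SkelState V} (h : SkelInv G accept s) (hs : s.Final) (a b : V) :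
    s.skel.Adj a b ↔ G.Adj a b ∨ G.Adj b a := by
  classical
  refine ⟨fun hab => ?_, h.le a b⟩
  by_contra hn
  have key : ∀ a b, s.skel.Adj a b → ¬ (G.Adj a b ∨ G.Adj b a) →
      ¬ ¬ Relation.TransGen G.Adj a b := by
    intro a b hab hn hr
    have hna : NonAdjacent G a b := ⟨hab.ne, not_or.1 hn⟩
    -- Since true edges are never deleted, the parents of `a` are still neighbours. Finality bounds
    -- their number by the last level, so this set must have been tried and rejected.
    have hsub : ((Finset.univ.filter fun q => G.Adj q a : Finset V) : Set V) ⊆ s.nbrs a b := by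
      intro q hq
      have hq : G.Adj q a := by simpa using hq
      refine ⟨h.le a q (.inr hq), ?_⟩
      rintro rfl
      exact hna.2.2 hq
    have hcard := SkelState.card_le_ncard hsub
    refine h.rej a b _ hab hsub ?_ ((hacc a b _ hab.ne (by simpa using hG.irrefl a)
      (by simpa using hna.2.2)).2 (not_dConnected_parents hG hna hr))
    rcases (hcard.trans (hs.2 a b hab)).lt_or_eq with h' | h'
    · exact .inl h'
    · refine .inr ⟨h', ?_⟩
      by_contra hd
      exact hs.1 a b ⟨hab, h' ▸ hcard, hd⟩
  rcases hG.not_transGen_or a b with h' | h'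
  · exact key a b hab hn h'
  · exact key b a hab.symm (fun h => hn h.symm) h'

variable [DecidableEq V]

/-- Neighbourhoods only shrink, so a set that is still a candidate was one before and its rejection
persists. On a change of level, a pair with a candidate of the old size must have been treated, or
it would still be selectable. -/
theorem SkelInv.step (hG : IsDAG G)
    (hacc : ∀ i j k, i ≠ j → i ∉ k → j ∉ k → (accept i j k ↔ ¬ DConnected G i j k))
    {s s' : SkelState V} (h : SkelInv G accept s) (hs : SkelStep accept s s') :
    SkelInv G accept s' := by
  cases hs with
  | delete i j k hij hk hk' =>
    have hsep := (hacc i j k hij.1.ne hk.notMem.1 hk.notMem.2).1 hk'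
    have hdel : ∀ a b, (s.skel.deleteEdges {s(i, j)}).Adj a b ↔
        s.skel.Adj a b ∧ ¬ ((a = i ∧ b = j) ∨ (a = j ∧ b = i)) := by
      intro a b
      simp [SimpleGraph.deleteEdges_adj]
    refine ⟨fun a b hab => ?_, fun a b hab hn => ?_, fun a b k' hab hk' hc => ?_⟩
    · rw [hdel]
      refine ⟨h.le a b hab, ?_⟩
      rintro (⟨rfl, rfl⟩ | ⟨rfl, rfl⟩)
      · exact hsep (dConnected_of_adj hG hab k)
      · exact hsep (dConnected_of_adj hG hab.symm k)
    · rw [hdel] at hn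
      dsimp only
      split_ifs with hc
      · rcases hc with ⟨rfl, rfl⟩ | ⟨rfl, rfl⟩
        · exact .inl hsep
        · exact .inr hsep
      · exact h.sep a b hab fun h' => hn ⟨h', hc⟩
    · rw [hdel] at hab
      refine h.rej a b k' hab.1 (fun x hx => ?_) (hc.imp id fun hc => ⟨hc.1, ?_⟩)
      · exact ⟨((hdel a x).1 (hk' hx).1).1, (hk' hx).2⟩
      · refine hc.2.resolve_left fun h' => hab.2 (.inl ?_)
        simpa using h'
  | keep i j hij hrej =>
    refine ⟨h.le, h.sep, fun a b k hab hk hc => ?_⟩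
    rcases hc with hc | ⟨hc, hc' | hc'⟩
    · exact h.rej a b k hab hk (.inl hc)
    · obtain ⟨rfl, rfl⟩ := Prod.mk.inj hc'
      exact hrej k ⟨hk, hc⟩
    · exact h.rej a b k hab hk (.inr ⟨hc, hc'⟩)
  | nextLevel hdone hmore =>
    refine ⟨h.le, h.sep, fun a b k hab hk hc => ?_⟩
    rcases hc with hc | hc
    · refine h.rej a b k hab hk ?_
      rcases Nat.lt_succ_iff_lt_or_eq.1 hc with hc | hc
      · exact .inl hc
      · refine .inr ⟨hc, ?_⟩
        by_contra hd
        exact hdone a b ⟨hab, hc ▸ SkelState.card_le_ncard hk, hd⟩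
    · exact absurd hc.2 (Set.notMem_empty _)

theorem SkelInv.of_reflTransGen (hG : IsDAG G)
    (hacc : ∀ i j k, i ≠ j → i ∉ k → j ∉ k → (accept i j k ↔ ¬ DConnected G i j k))
    {s : SkelState V} (hs : Relation.ReflTransGen (SkelStep accept) (SkelState.init V) s) :
    SkelInv G accept s := by
  induction hs with
  | refl => exact .init hG
  | tail _ hst ih => exact ih.step hG hacc hst

/-- The skeleton search terminates. -/
theorem exists_skelStep_final (accept : V → V → Finset V → Prop) (s : SkelState V) :
    ∃ s', Relation.ReflTransGen (SkelStep accept) s s' ∧ s'.Final := by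
  -- This encodes the lexicographic order on remaining levels and untreated pairs; the factor
  -- exceeds the number of pairs, so a new level pays for emptying `done`.
  induction hn : (Fintype.card V - s.level) * (Fintype.card (V × V) + 1) + s.doneᶜ.ncard using
    Nat.strong_induction_on generalizing s with
  | _ n ih =>
  subst hn
  have hins : ∀ i j, (i, j) ∉ s.done → (insert (i, j) s.done)ᶜ.ncard < s.doneᶜ.ncard := by
    intro i j hij
    refine Set.ncard_lt_ncard ((Set.ssubset_iff_of_subset ?_).2 ⟨(i, j), hij, ?_⟩) (Set.toFinite _)
    · exact Set.compl_subset_compl.2 (Set.subset_insert _ _)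
    · simp
  by_cases hsel : ∃ i j, s.Selectable i j
  · obtain ⟨i, j, hij⟩ := hsel
    by_cases hk : ∃ k, s.Candidate i j k ∧ accept i j k
    · obtain ⟨k, hk, hk'⟩ := hk
      obtain ⟨s', h1, h2⟩ := ih _ (Nat.add_lt_add_left (hins i j hij.2.2) _)
        { level := s.level
          skel := s.skel.deleteEdges {s(i, j)}
          sep := fun a b => if (a = i ∧ b = j) ∨ (a = j ∧ b = i) then k else s.sep a b
          done := insert (i, j) s.done } rfl
      exact ⟨s', .head (.delete s i j k hij hk hk') h1, h2⟩
    · push Not at hk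
      obtain ⟨s', h1, h2⟩ := ih _ (Nat.add_lt_add_left (hins i j hij.2.2) _)
        { s with done := insert (i, j) s.done } rfl
      exact ⟨s', .head (.keep s i j hij hk) h1, h2⟩
  · push Not at hsel
    by_cases hmore : ∃ i j, s.skel.Adj i j ∧ s.level < (s.nbrs i j).ncard
    · have hlev : s.level < Fintype.card V := by
        obtain ⟨i, j, -, hij⟩ := hmore
        rw [← Nat.card_eq_fintype_card]
        exact hij.trans_le (Set.ncard_le_card _)
      obtain ⟨m, hm⟩ : ∃ m, Fintype.card V - s.level = m + 1 :=
        ⟨Fintype.card V - s.level - 1, by omega⟩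
      have hm' : Fintype.card V - (s.level + 1) = m := by omega
      have hle : ((∅ : Set (V × V))ᶜ).ncard ≤ Fintype.card (V × V) := by
        rw [← Nat.card_eq_fintype_card]
        exact Set.ncard_le_card _
      have hlt : (Fintype.card V - (s.level + 1)) * (Fintype.card (V × V) + 1) +
          ((∅ : Set (V × V))ᶜ).ncard <
          (Fintype.card V - s.level) * (Fintype.card (V × V) + 1) + s.doneᶜ.ncard := by
        rw [hm, hm', Nat.add_mul m 1]
        omega
      obtain ⟨s', h1, h2⟩ := ih _ hlt { s with level := s.level + 1, done := ∅ } rfl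
      exact ⟨s', .head (.nextLevel s hsel hmore) h1, h2⟩
    · push Not at hmore
      exact ⟨s, .refl, hsel, hmore⟩

end SkeletonSearch

/-! ### The v-structure phase and the oracle version of the theorem -/

section ColliderPhase

variable {V : Type*} {G : Digraph V}

theorem orientCollider_adj_iff (hG : IsDAG G) {E : Digraph V} (hE : ∀ a b, G.Adj a b → E.Adj a b)
    {t : V × V × V} (ht : VStruct G t.1 t.2.1 t.2.2) (a b : V) :
    (orientCollider E t).Adj a b ↔ E.Adj a b ∧ ¬ (a = t.2.1 ∧ (b = t.1 ∨ b = t.2.2)) := by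
  have h1 := orient_adj_iff (hE _ _ ht.2.1) (hG.ne ht.2.1)
  have h2 : (orient E t.1 t.2.1).Adj t.2.2 t.2.1 :=
    (h1 _ _).2 ⟨hE _ _ ht.2.2, fun h => hG.ne ht.2.2 h.1⟩
  rw [orientCollider, orient_adj_iff h2 (hG.ne ht.2.2), h1]
  tauto

/-- All arrows drawn are edges of `G`, so no orientation overwrites an earlier one and the order is
immaterial. -/
theorem foldl_orientCollider_adj_iff (hG : IsDAG G) (l : List (V × V × V))
    (hl : ∀ t ∈ l, VStruct G t.1 t.2.1 t.2.2) {E : Digraph V}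
    (hE : ∀ a b, G.Adj a b → E.Adj a b) (a b : V) :
    (l.foldl orientCollider E).Adj a b ↔
      E.Adj a b ∧ ∀ t ∈ l, ¬ (a = t.2.1 ∧ (b = t.1 ∨ b = t.2.2)) := by
  induction l generalizing E with
  | nil => simp
  | cons t l ih =>
    have ht := hl t (by simp)
    have h1 := orientCollider_adj_iff hG hE ht
    rw [List.foldl_cons, ih (fun t ht => hl t (by simp [ht])), h1]
    · simp only [List.forall_mem_cons, and_assoc]
    · intro a b hab
      refine (h1 a b).2 ⟨hE a b hab, ?_⟩
      rintro ⟨rfl, rfl | rfl⟩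
      · exact hG.asymm hab ht.2.1
      · exact hG.asymm hab ht.2.2

variable {accept : V → V → Finset V → Prop}

theorem SkelInv.mem_colliderTriples_iff (hG : IsDAG G) {s : SkelState V} (h : SkelInv G accept s)
    (hadj : ∀ a b, s.skel.Adj a b ↔ G.Adj a b ∨ G.Adj b a) (t : V × V × V) :
    t ∈ colliderTriples s ↔ VStruct G t.1 t.2.1 t.2.2 := by
  obtain ⟨a, c, b⟩ := t
  have key : a ≠ b → ¬ s.skel.Adj a b → s.skel.Adj a c → s.skel.Adj c b →
      (c ∉ s.sep a b ↔ IsCollider G a c b) := by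
    intro hab hn h1 h2
    rcases h.sep a b hab hn with h' | h'
    · exact notMem_sepset_iff hG hab ((hadj a c).1 h1) ((hadj c b).1 h2) h'
    · exact (notMem_sepset_iff hG hab.symm ((hadj c b).1 h2).symm ((hadj a c).1 h1).symm h').trans
        and_comm
  constructor
  · rintro ⟨hab, hn, h1, h2, h3⟩
    exact ⟨⟨hab, not_or.1 fun h => hn ((hadj _ _).2 h)⟩, (key hab hn h1 h2).1 h3⟩
  · rintro ⟨hn, hc⟩
    have hn' : ¬ s.skel.Adj a b := fun h => not_or.2 hn.2 ((hadj _ _).1 h)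
    have h1 : s.skel.Adj a c := (hadj _ _).2 (.inl hc.1)
    have h2 : s.skel.Adj c b := (hadj _ _).2 (.inr hc.2)
    exact ⟨hn.1, hn', h1, h2, (key hn.1 hn' h1 h2).2 hc⟩

variable [Fintype V]

theorem SkelInv.colliderPhase_iff (hG : IsDAG G) {s : SkelState V} (h : SkelInv G accept s)
    (hadj : ∀ a b, s.skel.Adj a b ↔ G.Adj a b ∨ G.Adj b a) (E : Digraph V) :
    ColliderPhase s E ↔ E = pattern G := by
  have hfold : ∀ l : List (V × V × V), (∀ t, t ∈ l ↔ t ∈ colliderTriples s) →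
      l.foldl orientCollider ⟨s.skel.Adj⟩ = pattern G := by
    intro l hl
    have hl' : ∀ t, t ∈ l ↔ VStruct G t.1 t.2.1 t.2.2 := fun t =>
      (hl t).trans (h.mem_colliderTriples_iff hG hadj t)
    ext a b
    rw [foldl_orientCollider_adj_iff hG l (fun t => (hl' t).1) fun a b h => (hadj a b).2 (.inl h)]
    refine and_congr (hadj a b) ⟨?_, ?_⟩
    · rintro h ⟨c, hc⟩
      exact h (b, a, c) ((hl' _).2 hc) ⟨rfl, .inl rfl⟩
    · rintro h ⟨x, y, z⟩ ht ⟨rfl, rfl | rfl⟩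
      · exact h ⟨_, (hl' _).1 ht⟩
      · exact h ⟨_, ((hl' _).1 ht).symm⟩
  constructor
  · rintro ⟨l, -, hl, rfl⟩
    exact hfold l hl
  · rintro rfl
    have hl : ∀ t, t ∈ (Set.toFinite (colliderTriples s)).toFinset.toList ↔
        t ∈ colliderTriples s := by simp
    exact ⟨_, Finset.nodup_toList _, hl, (hfold _ hl).symm⟩

/-- With an oracle for d-separation in `G`, all executions of the PC algorithm return the CPDAG of
`G`, and there is such an execution. -/
theorem pcOutputs_eq [DecidableEq V] (hG : IsDAG G) (hcl : markovClass G = {D | SamePattern G D})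
    (hacc : ∀ i j k, i ≠ j → i ∉ k → j ∉ k → (accept i j k ↔ ¬ DConnected G i j k)) :
    pcOutputs accept = {cpdag G} := by
  apply Set.eq_singleton_iff_unique_mem.2
  constructor
  · obtain ⟨s, hs, hfin⟩ := exists_skelStep_final accept (SkelState.init V)
    have hinv := SkelInv.of_reflTransGen hG hacc hs
    obtain ⟨F, hF, hFfin⟩ := exists_ruleStep_final hG (Sound.pattern G)
    refine ⟨s, hs, hfin, pattern G,
      (hinv.colliderPhase_iff hG (hinv.adj_iff hG hacc hfin) _).2 rfl, ?_⟩
    rw [← eq_cpdag hG hcl hF hFfin]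
    exact ⟨hF, hFfin⟩
  · rintro F ⟨s, hs, hfin, E, hE, hF, hFfin⟩
    have hinv := SkelInv.of_reflTransGen hG hacc hs
    rw [hinv.colliderPhase_iff hG (hinv.adj_iff hG hacc hfin)] at hE
    subst hE
    exact eq_cpdag hG hcl hF hFfin

end ColliderPhase

/-! ### From the oracle to the sample version -/

section Probability

/-- If `A n` happens outside of finitely many events whose probabilities tend to zero, then the
probability of `A n` tends to one. -/
theorem tendsto_measure_one_of_forall_notMem {Ω ι : Type*} [Finite ι] [MeasurableSpace Ω]
    (ν : Measure Ω) [IsProbabilityMeasure ν] {A : ℕ → Set Ω} {B : ι → ℕ → Set Ω}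
    (hB : ∀ i, Tendsto (fun n => ν (B i n)) atTop (𝓝 0))
    (hA : ∀ n ω, (∀ i, ω ∉ B i n) → ω ∈ A n) : Tendsto (fun n => ν (A n)) atTop (𝓝 1) := by
  classical
  have := Fintype.ofFinite ι
  have hsum : Tendsto (fun n => 1 - ∑ i, ν (B i n)) atTop (𝓝 1) := by
    have h : Tendsto (fun n => ∑ i, ν (B i n)) atTop (𝓝 0) := by
      simpa using tendsto_finsetSum Finset.univ fun i _ => hB i
    simpa using ENNReal.Tendsto.sub (tendsto_const_nhds (x := (1 : ENNReal))) h (.inl (by simp))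
  refine tendsto_of_tendsto_of_tendsto_of_le_of_le hsum tendsto_const_nhds (fun n => ?_)
    fun n => prob_le_one
  rw [tsub_le_iff_right, ← measure_univ (μ := ν)]
  -- Only monotonicity and subadditivity are used, so the events need not be measurable.
  have hsub : Set.univ ⊆ A n ∪ ⋃ i, B i n := by
    intro ω _
    by_cases h : ∃ i, ω ∈ B i n
    · exact .inr (Set.mem_iUnion.2 h)
    · push Not at h
      exact .inl (hA n ω h)
  calc ν Set.univ ≤ ν (A n ∪ ⋃ i, B i n) := measure_mono hsub
    _ ≤ ν (A n) + ν (⋃ i, B i n) := measure_union_le _ _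
    _ ≤ ν (A n) + ∑ i, ν (B i n) := by gcongr; exact measure_iUnion_fintype_le _ _

theorem exists_abs_le_iff {γ m : ℝ} (hγ : 0 < γ) (hm : m ≠ 0 → γ < |m|) :
    ∃ ε > 0, ∀ x, ¬ ε ≤ dist x m → (|x| ≤ γ ↔ m = 0) := by
  by_cases h : m = 0
  · subst h
    refine ⟨γ, hγ, fun x hx => ?_⟩
    rw [Real.dist_eq, sub_zero, not_le] at hx
    simp [hx.le]
  · refine ⟨|m| - γ, sub_pos.2 (hm h), fun x hx => iff_of_false (fun hx' => ?_) h⟩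
    rw [Real.dist_eq, not_le, abs_sub_comm] at hx
    have := abs_sub_abs_le_abs_sub m x
    linarith

end Probability

end PCAlg

/-- `X 0, X 1, …` are identically distributed with law `P` (with no restriction on their
dependence), `mu i j k` is a measure of conditional dependence, `muHat n i j k` is the estimator
computed from the first `n` observations. With probability tending to one, the CPDAG of `G` is the
one and only possible result of the sample PC algorithm, whatever choices it makes. -/
theorem mainTheorem1 {V : Type*} [Fintype V] [DecidableEq V]
    (G : Digraph V) (hG : PCAlg.IsDAG G)
    (P : Measure (V → ℝ)) [IsProbabilityMeasure P] (hP : PCAlg.Faithful P G)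
    {Ω : Type*} [MeasurableSpace Ω] (ν : Measure Ω) [IsProbabilityMeasure ν]
    (X : ℕ → Ω → V → ℝ) (hX : ∀ t, HasLaw (X t) P ν)
    (mu : V → V → Finset V → ℝ)
    (hmu : ∀ i j k, i ≠ j → i ∉ k → j ∉ k →
      (mu i j k = 0 ↔ PCAlg.CondIndepCoord P {i} {j} k))
    (muHat : (n : ℕ) → V → V → Finset V → (Fin n → V → ℝ) → ℝ)
    (hmeas : ∀ n i j k, i ≠ j → i ∉ k → j ∉ k → Measurable (muHat n i j k))
    (hcons : ∀ i j k, i ≠ j → i ∉ k → j ∉ k →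
      TendstoInMeasure ν (fun n ω => muHat n i j k (fun t : Fin n => X t ω)) atTop (fun _ => mu i j k))
    (γ : ℝ) (hγ : 0 < γ)
    (hγmu : ∀ i j k, i ≠ j → i ∉ k → j ∉ k → mu i j k ≠ 0 → γ < |mu i j k|) :
    Tendsto
      (fun n : ℕ => ν {ω | PCAlg.samplePCOutputs (muHat n) γ (fun t : Fin n => X t ω) = {PCAlg.cpdag G}})
      atTop (𝓝 1) := by
  classical
  have key : ∀ q : V × V × Finset V, ∃ ε > 0, q.1 ≠ q.2.1 → q.1 ∉ q.2.2 → q.2.1 ∉ q.2.2 →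
      ∀ x, ¬ ε ≤ dist x (mu q.1 q.2.1 q.2.2) → (|x| ≤ γ ↔ mu q.1 q.2.1 q.2.2 = 0) := by
    rintro ⟨i, j, k⟩
    by_cases h : i ≠ j ∧ i ∉ k ∧ j ∉ k
    · obtain ⟨ε, hε, hx⟩ := PCAlg.exists_abs_le_iff hγ (hγmu i j k h.1 h.2.1 h.2.2)
      exact ⟨ε, hε, fun _ _ _ => hx⟩
    · exact ⟨1, one_pos, fun h1 h2 h3 => absurd ⟨h1, h2, h3⟩ h⟩
  choose ε hε hεx using key
  refine PCAlg.tendsto_measure_one_of_forall_notMem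
    (ι := {q : V × V × Finset V // q.1 ≠ q.2.1 ∧ q.1 ∉ q.2.2 ∧ q.2.1 ∉ q.2.2}) ν
    (B := fun q n => {ω | ε q ≤ dist (muHat n q.1.1 q.1.2.1 q.1.2.2 fun t : Fin n => X t ω)
      (mu q.1.1 q.1.2.1 q.1.2.2)})
    (fun q => tendstoInMeasure_iff_dist.1
      (hcons _ _ _ q.2.1 q.2.2.1 q.2.2.2) _ (hε q)) fun n ω hω => ?_
  refine PCAlg.pcOutputs_eq hG (PCAlg.markovClass_eq hG P hP) fun i j k hij hi hj => ?_
  rw [hεx (i, j, k) hij hi hj _ (hω ⟨(i, j, k), hij, hi, hj⟩), hmu i j k hij hi hj,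
    hP {i} {j} k (by simpa using hij) (by simpa using hi) (by simpa using hj),
    PCAlg.dSeparates_singleton]
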